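/- **Conventions.** On $\mathbb R^7$ let $$\psi_0=e^{2345}+e^{2367}+e^{4567}-e^{1247}+e^{1357}-e^{1346}-e^{1256}.$$ A linear isomorphism $u$ acts on forms by $(u\alpha)(v_1,\dots,v_k)=\alpha(u^{-1}v_1,\dots,u^{-1}v_k)$. Let $M^7$ be an oriented smooth $7$-manifold, with orientation given by a smooth nowhere vanishing $7$-form. A $G_2$-structure on $M$ is a smooth $4$-form $\psi$ such that at every $p\in M$ there is a positively oriented frame $u:\mathbb R^7\to T_pM$ with $u\psi_0=\psi_p$ (a Cayley frame). It induces the metric $g=g(\psi)$ for which Cayley frames are orthonormal, and the $3$-form $\varphi=*_\psi\psi$, the Hodge dual with respect to $g$ and the orientation. The intrinsic torsion $\mathcal T\in\mathrm{End}(TM)$ of $\psi$ is defined by $$\nabla^g_X\varphi=-(\mathcal TX)\lrcorner\psi\qquad\text{for all }X\in TM,$$ where $\nabla^g$ is the Levi-Civita connection of $g$. Finally $D_\psi:\mathrm{End}(TM)\to\Lambda^4T^*M$ is defined by $D_\psi(B)=\frac{d}{ds}\big|_{s=0}\exp(sB)\psi$. **Proposition 3.1.** Let $\psi$ be a $G_2$-structure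 on $M^7$, let $I\subset\mathbb R$ be an interval with more than one point, and let $(A_t)_{t\in I}$ be a family of smooth sections of $\mathrm{Aut}(TM)$ which is differentiable in $t$ at every point of $M$. Let $\psi_t=A_t\psi$, let $\varphi_t=*_{\psi_t}\psi_t$, and let $\mathcal T_t$ be the intrinsic torsion of $\psi_t$. Then for every $t\in I$ $$\dot\psi_t=d\varphi_t\quad\Longleftrightarrow\quad D_{\psi_t}(\dot A_t\circ A_t^{-1})=D_{\psi_t}(\mathcal T_t).$$ (At an end point of $I$ the $t$-derivatives are one-sided.) -/

import Mathlib

open scoped Manifold ContDiff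

noncomputable section

namespace G2Flow

/-! ### Linear algebra on the model space `ℝ⁷` -/

/-- Euclidean `ℝ⁷`, the model space of all manifolds below. -/
abbrev R7 : Type := EuclideanSpace ℝ (Fin 7)

/-- The standard basis vectors of `ℝ⁷`, indexed by `0, …, 6`. -/
def stdVec (i : Fin 7) : R7 := EuclideanSpace.single i 1

/-- The decomposable form `e^{s 0} ∧ ⋯ ∧ e^{s (k-1)}` on `ℝ⁷`, normalised so that (for injective
`s`) its value on `(e_{s 0}, …, e_{s (k-1)})` is `1`. Indices run from `0` to `6`. -/
def coordForm {k : ℕ} (s : Fin k → Fin 7) : R7 [⋀^Fin k]→L[ℝ] ℝ where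
  toFun v := Matrix.det (Matrix.of fun a b => v a (s b))
  map_update_add' := by
    intro _ v i x y
    have h (z : R7) : (Matrix.of fun a b => (Function.update v i z) a (s b))
        = Matrix.updateRow (Matrix.of fun a b => v a (s b)) i (fun b => z (s b)) := by
      ext a b
      by_cases h : a = i
      · subst h; simp
      · simp [h]
    have e : (fun b => (x + y) (s b)) = (fun b => x (s b)) + fun b => y (s b) := rfl
    convert Matrix.det_updateRow_add (Matrix.of fun a b => v a (s b)) i
      (fun b => x (s b)) (fun b => y (s b)) using 1
    · rw [← e, ← h]; congr!
    · rw [← h, ← h]; congr!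
  map_update_smul' := by
    intro _ v i c x
    have h (z : R7) : (Matrix.of fun a b => (Function.update v i z) a (s b))
        = Matrix.updateRow (Matrix.of fun a b => v a (s b)) i (fun b => z (s b)) := by
      ext a b
      by_cases h : a = i
      · subst h; simp
      · simp [h]
    have e : (fun b => (c • x) (s b)) = c • fun b => x (s b) := rfl
    convert Matrix.det_updateRow_smul (Matrix.of fun a b => v a (s b)) i c
      (fun b => x (s b)) using 1
    · rw [← e, ← h]; congr!
    · rw [← h, smul_eq_mul]; congr!
  map_eq_zero_of_eq' := by
    intro v i j h hij
    exact Matrix.det_zero_of_row_eq hij (by ext b; simp [h])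
  cont := by
    refine Continuous.matrix_det ?_
    refine continuous_matrix fun a b => ?_
    simp only [Matrix.of_apply]
    fun_prop

/-- The standard volume form `e^{1234567}` of `ℝ⁷`. -/
def vol0 : R7 [⋀^Fin 7]→L[ℝ] ℝ := coordForm id

/-- The model `4`-form
`e^{2345} + e^{2367} + e^{4567} - e^{1247} + e^{1357} - e^{1346} - e^{1256}`
(in the code the indices are shifted by one). -/
def psi0 : R7 [⋀^Fin 4]→L[ℝ] ℝ :=
  coordForm ![1, 2, 3, 4] + coordForm ![1, 2, 5, 6] + coordForm ![3, 4, 5, 6]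
    - coordForm ![0, 1, 3, 6] + coordForm ![0, 2, 4, 6] - coordForm ![0, 2, 3, 5]
    - coordForm ![0, 1, 4, 5]

/-- The Hodge star `Λ⁴ → Λ³` of Euclidean oriented `ℝ⁷`:
`*α = ∑_{i₁ < i₂ < i₃ < i₄} α(e_{i₁}, …, e_{i₄}) vol(e_{i₁}, …, e_{i₄}, ·, ·, ·)`,
that is, `*e^I = ± e^J` with `J` the complement of `I` and `e^I ∧ *e^I = vol`. -/
def hodgeStar0 (α : R7 [⋀^Fin 4]→L[ℝ] ℝ) : R7 [⋀^Fin 3]→L[ℝ] ℝ :=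
  ∑ s : Fin 4 ↪o Fin 7, α (fun i => stdVec (s i)) •
    ((((vol0.curryLeft (stdVec (s 0))).curryLeft (stdVec (s 1))).curryLeft
      (stdVec (s 2))).curryLeft (stdVec (s 3)))

/-- The natural action of linear isomorphisms on forms, `(u α)(v₁, …) = α(u⁻¹ v₁, …)`. -/
def push {V W : Type*} [AddCommGroup V] [Module ℝ V] [TopologicalSpace V]
    [AddCommGroup W] [Module ℝ W] [TopologicalSpace W] {k : ℕ}
    (u : V ≃L[ℝ] W) (α : V [⋀^Fin k]→L[ℝ] ℝ) : W [⋀^Fin k]→L[ℝ] ℝ :=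
  α.compContinuousLinearMap (u.symm : W →L[ℝ] V)

theorem exp_mul_exp_neg (B : R7 →L[ℝ] R7) : NormedSpace.exp B * NormedSpace.exp (-B) = 1 := by
  let _ : NormedAlgebra ℚ (R7 →L[ℝ] R7) := NormedAlgebra.restrictScalars ℚ ℝ (R7 →L[ℝ] R7)
  rw [← NormedSpace.exp_add_of_commute (Commute.refl B).neg_right, add_neg_cancel,
    NormedSpace.exp_zero]

/-- The automorphism `exp B`, with inverse `exp (-B)`. -/
def expAut (B : R7 →L[ℝ] R7) : R7 ≃L[ℝ] R7 :=
  ContinuousLinearEquiv.equivOfInverse (NormedSpace.exp B) (NormedSpace.exp (-B))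
    (fun x => by
      have h := exp_mul_exp_neg (-B)
      rw [neg_neg] at h
      simpa using congrArg (fun L : R7 →L[ℝ] R7 => L x) h)
    (fun x => by
      simpa using congrArg (fun L : R7 →L[ℝ] R7 => L x) (exp_mul_exp_neg B))

/-- `D_ψ(B) = d/ds|_{s=0} exp(sB)ψ`. -/
def infAct (ψ : R7 [⋀^Fin 4]→L[ℝ] ℝ) (B : R7 →L[ℝ] R7) : R7 [⋀^Fin 4]→L[ℝ] ℝ :=
  deriv (fun s : ℝ => push (expAut (s • B)) ψ) 0

/-! ### Differential forms and gauge deformations on a seven-manifold -/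

section Manifold

variable {M : Type*} [TopologicalSpace M] [ChartedSpace R7 M]

/-- The tangent space of `M` at `p`. As a topological vector space Mathlib realises it as a copy of
`ℝ⁷` (via the preferred chart at `p`); this is used below to give the finite-dimensional spaces
`End(T_pM)` and `Λᵏ T_p^*M` their norm when differentiating in a real parameter. -/
abbrev Tan (p : M) : Type := TangentSpace (𝓡 7) p

variable (M) in
/-- (Not necessarily smooth) differential `k`-forms on `M`. -/
abbrev Form (k : ℕ) : Type _ := (p : M) → Tan p [⋀^Fin k]→L[ℝ] ℝ

/-- The differential at `p` of the preferred chart `κ` at `p`. -/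
def chartDiff (p : M) : Tan p →L[ℝ] R7 :=
  mfderiv (𝓡 7) (𝓡 7) (extChartAt (𝓡 7) p) p

/-- The differential at `x` of the inverse `κ⁻¹` of the preferred chart at `p`. -/
def chartSymmDiff (p : M) (x : R7) : R7 →L[ℝ] Tan ((extChartAt (𝓡 7) p).symm x) :=
  mfderiv (𝓡 7) (𝓡 7) (extChartAt (𝓡 7) p).symm x

/-- The local representation `(κ⁻¹)^* α` of a form in the preferred chart `κ` at `p`. -/
def inChart {k : ℕ} (α : Form M k) (p : M) : R7 → R7 [⋀^Fin k]→L[ℝ] ℝ := fun x =>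
  (α ((extChartAt (𝓡 7) p).symm x)).compContinuousLinearMap (chartSymmDiff p x)

/-- Smoothness of a differential form: all its local representations are smooth. -/
def IsSmoothForm {k : ℕ} (α : Form M k) : Prop :=
  ∀ p : M, ContDiffOn ℝ ∞ (inChart α p) (extChartAt (𝓡 7) p).target

/-- The exterior derivative, computed at `p` in the preferred chart `κ` at `p`:
`(dα)_p = (κ^* d((κ⁻¹)^* α))_p`. -/
def extD {k : ℕ} (α : Form M k) : Form M (k + 1) := fun p =>
  (extDeriv (inChart α p) (extChartAt (𝓡 7) p p)).compContinuousLinearMap (chartDiff p)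

variable (M) in
/-- (Not necessarily smooth) sections of `Aut(TM)`. -/
abbrev Gauge : Type _ := (p : M) → Tan p ≃L[ℝ] Tan p

/-- Smoothness of a section of `Aut(TM)`, as a section of the vector bundle `End(TM)`. -/
def IsSmoothGauge [IsManifold (𝓡 7) ∞ M] (A : Gauge M) : Prop :=
  ContMDiff (𝓡 7) ((𝓡 7).prod 𝓘(ℝ, R7 →L[ℝ] R7)) ∞
    (fun p => Bundle.TotalSpace.mk' (R7 →L[ℝ] R7)
      (E := fun p : M => Tan p →L[ℝ] Tan p) p (A p : Tan p →L[ℝ] Tan p))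

/-- The gauge deformation `Aψ` of a form. -/
def gaugeAct {k : ℕ} (A : Gauge M) (α : Form M k) : Form M k := fun p => push (A p) (α p)

/-- The velocity `Ȧ_t ∈ End(T_pM)` at time `t ∈ I` of a family of gauge deformations; it is
one-sided at an end point of `I`. -/
def gaugeVelocity (A : ℝ → Gauge M) (I : Set ℝ) (t : ℝ) (p : M) : Tan p →L[ℝ] Tan p :=
  derivWithin (fun s => ((A s p : Tan p →L[ℝ] Tan p) : R7 →L[ℝ] R7)) I t

/-- The velocity `α̇_t` at time `t ∈ I` of a family of differential forms. -/
def formVelocity {k : ℕ} (α : ℝ → Form M k) (I : Set ℝ) (t : ℝ) : Form M k := fun p =>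
  derivWithin (fun s => (α s p : R7 [⋀^Fin k]→L[ℝ] ℝ)) I t

/-- The bundle map `D_ψ : End(TM) → Λ⁴T^*M`, `B ↦ d/ds|_{s=0} exp(sB)ψ`, at the point `p`. -/
def infActAt (ψ : Form M 4) (p : M) (B : Tan p →L[ℝ] Tan p) : Tan p [⋀^Fin 4]→L[ℝ] ℝ :=
  infAct (ψ p) B

/-! ### `G₂`-structures -/

/-- `u` is a Cayley frame at `p`: it is positive with respect to the orientation `[ε]` and `ψ_p`
takes the model form `psi0` in this frame. -/
def IsCayleyFrame (ε : Form M 7) (ψ : Form M 4) (p : M) (u : R7 ≃L[ℝ] Tan p) : Prop :=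
  push u psi0 = ψ p ∧ 0 < ε p (fun i => u (stdVec i))

/-- A `G₂`-structure on `M` with orientation `[ε]`: a smooth `4`-form of type `psi0`. -/
structure IsG2Structure (ε : Form M 7) (ψ : Form M 4) : Prop where
  smooth : IsSmoothForm ψ
  exists_cayleyFrame : ∀ p, ∃ u : R7 ≃L[ℝ] Tan p, IsCayleyFrame ε ψ p u

open Classical in
/-- Some Cayley frame at `p` (it is unique up to the action of `G₂ ⊂ SO(7)`). -/
def cayleyFrame (ε : Form M 7) (ψ : Form M 4) (p : M) : R7 ≃L[ℝ] Tan p :=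
  if h : ∃ u : R7 ≃L[ℝ] Tan p, IsCayleyFrame ε ψ p u then h.choose
  else ContinuousLinearEquiv.refl ℝ R7

/-- The metric `g(ψ)`, for which Cayley frames are orthonormal. -/
def metric (ε : Form M 7) (ψ : Form M 4) (p : M) (X Y : Tan p) : ℝ :=
  inner ℝ ((cayleyFrame ε ψ p).symm X) ((cayleyFrame ε ψ p).symm Y)

/-- The `3`-form `φ = *ψ`, the Hodge dual being that of the metric and orientation for which Cayley
frames are orthonormal and positive. -/
def phi (ε : Form M 7) (ψ : Form M 4) : Form M 3 := fun p =>
  push (cayleyFrame ε ψ p) (hodgeStar0 (push (cayleyFrame ε ψ p).symm (ψ p)))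

/-! ### The Levi-Civita connection of `g(ψ)` and the intrinsic torsion -/

/-- The metric `g(ψ)` in the preferred chart at `p`. -/
def metricInChart (ε : Form M 7) (ψ : Form M 4) (p : M) (x : R7) (X Y : R7) : ℝ :=
  metric ε ψ ((extChartAt (𝓡 7) p).symm x) (chartSymmDiff p x X) (chartSymmDiff p x Y)

/-- Christoffel symbols of the first kind at `p`, in the preferred chart at `p`:
`½ (∂_X g(Y, Z) + ∂_Y g(X, Z) - ∂_Z g(X, Y))`. -/
def christoffelFirst (ε : Form M 7) (ψ : Form M 4) (p : M) (X Y Z : R7) : ℝ :=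
  let x := extChartAt (𝓡 7) p p
  (1 / 2 : ℝ) * (fderiv ℝ (fun y => metricInChart ε ψ p y Y Z) x X
    + fderiv ℝ (fun y => metricInChart ε ψ p y X Z) x Y
    - fderiv ℝ (fun y => metricInChart ε ψ p y X Y) x Z)

/-- Christoffel symbols of the second kind at `p`, in the preferred chart at `p`:
`Γ(X, Y) = ∑_{k, l} g^{kl} Γ_l(X, Y) e_k`. -/
def christoffel (ε : Form M 7) (ψ : Form M 4) (p : M) (X Y : R7) : R7 :=
  let G : Matrix (Fin 7) (Fin 7) ℝ := Matrix.of fun i j =>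
    metricInChart ε ψ p (extChartAt (𝓡 7) p p) (stdVec i) (stdVec j)
  ∑ k, (∑ l, G⁻¹ k l * christoffelFirst ε ψ p X Y (stdVec l)) • stdVec k

/-- The covariant derivative `(∇^g_X α)(v₁, …, v_k)` at `p` of a form, for the Levi-Civita
connection of `g = g(ψ)`: in the preferred chart at `p` it is
`(∂_X α)(v₁, …, v_k) - ∑ᵢ α(v₁, …, Γ(X, vᵢ), …, v_k)`. -/
def covDeriv (ε : Form M 7) (ψ : Form M 4) {k : ℕ} (α : Form M k) (p : M) (X : Tan p)
    (v : Fin k → Tan p) : ℝ :=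
  let x := extChartAt (𝓡 7) p p
  let X' : R7 := chartDiff p X
  let v' : Fin k → R7 := fun i => chartDiff p (v i)
  fderiv ℝ (inChart α p) x X' v'
    - ∑ i, inChart α p x (Function.update v' i (christoffel ε ψ p X' (v' i)))

/-- The defining equation `∇^g_X φ = -(𝒯X ⌟ ψ)` (for all `X ∈ T_pM`) of the intrinsic torsion
at `p`. -/
def IsTorsionAt (ε : Form M 7) (ψ : Form M 4) (p : M) (T : Tan p →L[ℝ] Tan p) : Prop :=
  ∀ (X : Tan p) (v : Fin 3 → Tan p),
    covDeriv ε ψ (phi ε ψ) p X v = -(ψ p (Matrix.vecCons (T X) v))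

open Classical in
/-- The intrinsic torsion `𝒯 ∈ End(TM)` of a `G₂`-structure: the endomorphism solving
`∇^g_X φ = -(𝒯X ⌟ ψ)`. -/
def intrinsicTorsion (ε : Form M 7) (ψ : Form M 4) (p : M) : Tan p →L[ℝ] Tan p :=
  if h : ∃ T : Tan p →L[ℝ] Tan p, IsTorsionAt ε ψ p T then h.choose else 0

end Manifold

end G2Flow

end

/-!
The velocity of `ψ_t = A_t ψ` is `D_{ψ_t}(Ȧ_t A_t⁻¹)` by the chain rule (`derivWithin_push`), so the
equivalence follows from the identity `dφ = D_ψ(𝒯)` (`extD_phi_eq_infActAt`), valid at every point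
for the `4`-form `ψ_t`. As the Levi-Civita connection is torsion free, `dφ` is the alternation of
`∇φ`, and the alternation of `-(𝒯 · ⌟ ψ)` is `-∑ ψ(…, 𝒯 ·, …) = D_ψ(𝒯)`
(`extDeriv_eq_infAct`). This uses the defining equation of `𝒯`, so what has to be proved is that the
equation has a solution (`isTorsionAt_intrinsicTorsion`).

Existence of the torsion rests on the following facts of linear algebra about the model forms.
* The `GL(7, ℝ)`-orbit of `ψ₀` is open: `B ↦ D_{ψ₀}(B)` has a right inverse
  (`exists_rightInverse_derivAct_psi0`). By the inverse function theorem a `4`-form of type `ψ₀` is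
  brought to the model, near any given point, by a coframe which is as differentiable as the form
  (`exists_differentiable_coframe`).
* A linear automorphism fixing `ψ₀` is orthogonal (`inner_eq_of_psi0_invariant`), and one that
  preserves the orientation as well fixes `φ₀ = *ψ₀` (`phi0_invariant`). Hence the metric and `φ`,
  defined by an arbitrary choice of a Cayley frame at each point, are computed by any Cayley frame,
  and are differentiable.
* A skew endomorphism moves `φ₀` by the contraction of `ψ₀` with a vector
  (`derivAct_phi0_of_skew`).

In such a coframe `b` the covariant derivative `∇_X φ` is the infinitesimal action on `φ₀` of
`(∂_X b - b Γ(X)) b⁻¹`. This endomorphism is skew because `∇` is metric, so `∇_X φ` is a contraction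
of `ψ` with a vector depending linearly on `X` (`exists_torsion_of_coframe`).

The identities of `G₂`-linear algebra are identities between the structure constants of `φ₀` and
`ψ₀`, which are integers, and are verified by evaluation.
-/

noncomputable section

namespace G2Flow

/-! ### Structure constants -/

/-- The sign of the product of two distinct imaginary octonion units, indexed by `0, …, 6`. The bits
of the literal record the negative signs. -/
def octSign (a b : ℕ) : ℤ :=
  bif Nat.beq (Nat.land (Nat.shiftRight 0x260d68431a3154 (Nat.add (Nat.mul 8 a) b)) 1) 1 then -1
  else 1

/-- The structure constants of `φ₀`: the `i`-th and `j`-th units multiply to plus or minus the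
`k`-th one exactly when `k + 1` is the bitwise sum of `i + 1` and `j + 1`. -/
def phiTab (a b c : ℕ) : ℤ :=
  bif Nat.beq (Nat.xor a.succ b.succ) c.succ then octSign a b else 0

/-- The structure constants of `ψ₀`, obtained from those of `φ₀` by the contraction
`ψ_{abcd} = ∑ₘ φ_{abm} φ_{cdm}`, valid when `a` differs from `b`, `c` and `d`. -/
def psiTab (a b c d : ℕ) : ℤ :=
  bif Nat.beq (Nat.xor a.succ b.succ) (Nat.xor c.succ d.succ) then
    bif Nat.beq a b then 0 else bif Nat.beq a c then 0 else bif Nat.beq a d then 0 else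
      octSign a b * octSign c d
  else 0

/-- Universal quantification over `{0, …, 6}` as a Boolean. -/
def all7 (p : ℕ → Bool) : Bool := p 0 && p 1 && p 2 && p 3 && p 4 && p 5 && p 6

/-- Summation over `{0, …, 6}`. -/
def sum7 (f : ℕ → ℤ) : ℤ := f 0 + f 1 + f 2 + f 3 + f 4 + f 5 + f 6

theorem forall_of_all7 {p : ℕ → Bool} (h : all7 p) (i : Fin 7) : p i := by
  simp only [all7, Bool.and_eq_true] at h
  fin_cases i <;> simp_all

theorem sum7_eq (f : ℕ → ℤ) : sum7 f = ∑ i : Fin 7, f i := by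
  simp [sum7, Fin.sum_univ_seven]

-- The tables are `ℕ`-valued functions combined by Booleans, since the kernel evaluates `Nat.beq`,
-- `Nat.xor` and the other operations used here on numerals directly.
theorem phiTab_antisymm : all7 fun a => all7 fun b => all7 fun c =>
    phiTab b a c == -phiTab a b c && phiTab a c b == -phiTab a b c := by
  decide +kernel

theorem psiTab_antisymm : all7 fun a => all7 fun b => all7 fun c => all7 fun d =>
    psiTab b a c d == -psiTab a b c d && psiTab a c b d == -psiTab a b c d &&
      psiTab a b d c == -psiTab a b c d := by
  decide +kernel

/-- As an endomorphism of `Λ²`, contraction with `ψ₀` satisfies a quadratic equation: on `g₂` and on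
its complement `ℝ⁷` it has two different eigenvalues. -/
theorem psiTab_contract : all7 fun a => all7 fun b => all7 fun e => all7 fun f =>
    sum7 (fun c => sum7 fun d => psiTab a b c d * psiTab c d e f) ==
      4 * ((bif Nat.beq a e && Nat.beq b f then 1 else 0) -
        (bif Nat.beq a f && Nat.beq b e then 1 else 0)) + 2 * psiTab a b e f := by
  decide +kernel

/-- Twice the `(a, b, c)` component of `∑ φ₀(…, E ·, …)`, for the elementary matrix `E` sending
`e_j` to `e_i`, plus the component of the contraction `∑ₘ φ_{ijm} ψ_{mabc}`. Its symmetry in `i`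
and `j` means that a skew matrix moves `φ₀` by the contraction of `ψ₀` with a vector. -/
def skewCoeff (i j a b c : ℕ) : ℤ :=
  2 * ((bif Nat.beq j a then phiTab i b c else 0) + (bif Nat.beq j b then phiTab a i c else 0)
    + (bif Nat.beq j c then phiTab a b i else 0)) + sum7 fun m => phiTab i j m * psiTab m a b c

theorem skewCoeff_symm : all7 fun i => all7 fun j => all7 fun a => all7 fun b =>
    Nat.ble b a || all7 fun c => Nat.ble c b || skewCoeff i j a b c == skewCoeff j i a b c := by
  decide +kernel

/-- The `(m, a)` component of the contraction over three indices of `ψ₀` with the monomial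
`e^p ∧ e^q ∧ e^r ∧ e^s`. -/
def contractMonomial (p q r s m a : ℕ) : ℤ :=
  (bif Nat.beq a p then psiTab m q r s else 0) - (bif Nat.beq a q then psiTab m p r s else 0)
    + (bif Nat.beq a r then psiTab m p q s else 0) - (bif Nat.beq a s then psiTab m p q r else 0)

/-- The `(m, a)` entry of twelve times the matrix which a `G₂`-equivariant right inverse of
`B ↦ ∑ ψ₀(…, B ·, …)` assigns to `e^p ∧ e^q ∧ e^r ∧ e^s`. Such a right inverse is a combination of
the contraction with `ψ₀`, its transpose and its trace; the three coefficients are determined by the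
irreducible summands `1`, `7` and `27` of `Λ⁴`. -/
def monomialLift (p q r s m a : ℕ) : ℤ :=
  4 * contractMonomial p q r s m a + 2 * contractMonomial p q r s a m
    - bif Nat.beq m a then 3 * psiTab p q r s else 0

/-- `monomialLift` is a right inverse, checked on increasing indices `p, q, r, s` and
`a, b, c, d`. -/
theorem monomialLift_spec : all7 fun p => all7 fun q => Nat.ble q p || all7 fun r => Nat.ble r q ||
    all7 fun s => Nat.ble s r || all7 fun a => all7 fun b => Nat.ble b a ||
    all7 fun c => Nat.ble c b || all7 fun d => Nat.ble d c ||
    sum7 (fun m => psiTab m b c d * monomialLift p q r s m a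
        + psiTab a m c d * monomialLift p q r s m b
        + psiTab a b m d * monomialLift p q r s m c + psiTab a b c m * monomialLift p q r s m d) ==
      bif Nat.beq a p && Nat.beq b q && Nat.beq c r && Nat.beq d s then 12 else 0 := by
  decide +kernel

/-- The value of `coordForm s` on the standard basis vectors with indices `f`, by Laplace
expansion. -/
def coordTab : (k : ℕ) → (Fin k → ℕ) → (Fin k → ℕ) → ℤ
  | 0, _, _ => 1
  | k + 1, s, f => ∑ j : Fin (k + 1), if f 0 = s j then
      (-1) ^ (j : ℕ) * coordTab k (fun i => s (j.succAbove i)) (fun i => f i.succ) else 0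

theorem psiTab_eq_coordTab : all7 fun a => all7 fun b => Nat.ble b a || all7 fun c => Nat.ble c b ||
    all7 fun d => Nat.ble d c ||
    coordTab 4 ![1, 2, 3, 4] ![a, b, c, d] + coordTab 4 ![1, 2, 5, 6] ![a, b, c, d]
      + coordTab 4 ![3, 4, 5, 6] ![a, b, c, d] - coordTab 4 ![0, 1, 3, 6] ![a, b, c, d]
      + coordTab 4 ![0, 2, 4, 6] ![a, b, c, d] - coordTab 4 ![0, 2, 3, 5] ![a, b, c, d]
      - coordTab 4 ![0, 1, 4, 5] ![a, b, c, d] == psiTab a b c d := by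
  decide +kernel

theorem phiTab_eq_coordTab : all7 fun a => all7 fun b => Nat.ble b a || all7 fun c => Nat.ble c b ||
    coordTab 7 ![0, 1, 2, 3, 4, 5, 6] ![1, 2, 3, 4, a, b, c]
      + coordTab 7 ![0, 1, 2, 3, 4, 5, 6] ![1, 2, 5, 6, a, b, c]
      + coordTab 7 ![0, 1, 2, 3, 4, 5, 6] ![3, 4, 5, 6, a, b, c]
      - coordTab 7 ![0, 1, 2, 3, 4, 5, 6] ![0, 1, 3, 6, a, b, c]
      + coordTab 7 ![0, 1, 2, 3, 4, 5, 6] ![0, 2, 4, 6, a, b, c]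
      - coordTab 7 ![0, 1, 2, 3, 4, 5, 6] ![0, 2, 3, 5, a, b, c]
      - coordTab 7 ![0, 1, 2, 3, 4, 5, 6] ![0, 1, 4, 5, a, b, c] == phiTab a b c := by
  decide +kernel

/-! ### Antisymmetric tensors and the model four-form -/

theorem apply_comp_perm {ι : Type*} {n : ℕ} {F : (Fin (n + 1) → ι) → ℝ}
    (h : ∀ f (i : Fin n), F (f ∘ Equiv.swap i.castSucc i.succ) = -F f) (f : Fin (n + 1) → ι)
    (σ : Equiv.Perm (Fin (n + 1))) : F (f ∘ σ) = (Equiv.Perm.sign σ : ℤ) * F f := by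
  have hσ : σ ∈ Submonoid.closure
      (Set.range fun i : Fin n => Equiv.swap i.castSucc i.succ) := by
    rw [Equiv.Perm.mclosure_swap_castSucc_succ]; trivial
  induction hσ using Submonoid.closure_induction generalizing f with
  | mem x hx =>
    obtain ⟨i, rfl⟩ := hx
    have hi : i.castSucc ≠ i.succ := i.castSucc_lt_succ.ne
    rw [h, Equiv.Perm.sign_swap hi]; simp
  | one => simp
  | mul x y _ _ hx hy =>
    have e : f ∘ (x * y : Equiv.Perm _) = (f ∘ x) ∘ y := rfl
    rw [e, hy, hx]; push_cast [Equiv.Perm.sign_mul]; ring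

/-- Antisymmetric functions of `n + 1` indices are determined by their values on increasing
tuples. -/
theorem eq_of_eq_strictMono {ι : Type*} [LinearOrder ι] {n : ℕ} {F G : (Fin (n + 1) → ι) → ℝ}
    (hF : ∀ f (i : Fin n), F (f ∘ Equiv.swap i.castSucc i.succ) = -F f)
    (hG : ∀ f (i : Fin n), G (f ∘ Equiv.swap i.castSucc i.succ) = -G f)
    (h : ∀ f, StrictMono f → F f = G f) (f : Fin (n + 1) → ι) : F f = G f := by
  by_cases hf : Function.Injective f
  · have hs : StrictMono (f ∘ Tuple.sort f) :=
      (Tuple.monotone_sort f).strictMono_of_injective (hf.comp (Tuple.sort f).injective)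
    have e : f = (f ∘ Tuple.sort f) ∘ (Tuple.sort f).symm := by
      funext i; simp
    rw [e, apply_comp_perm hF, apply_comp_perm hG, h _ hs]
  · have key : ∀ {K : (Fin (n + 1) → ι) → ℝ},
        (∀ f (i : Fin n), K (f ∘ Equiv.swap i.castSucc i.succ) = -K f) → K f = 0 := by
      intro K hK
      simp only [Function.Injective, not_forall] at hf
      obtain ⟨a, b, hab, hne⟩ := hf
      have e : f ∘ Equiv.swap a b = f := by
        ext i
        simp only [Function.comp, Equiv.swap_apply_def]
        split_ifs <;> simp_all
      have := apply_comp_perm hK f (Equiv.swap a b)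
      rw [e, Equiv.Perm.sign_swap hne] at this
      push_cast at this; linarith
    rw [key hF, key hG]

theorem alternating_comp_swap {V : Type*} [AddCommGroup V] [Module ℝ V] [TopologicalSpace V]
    {ι : Type*} {n : ℕ} (α : V [⋀^Fin (n + 1)]→L[ℝ] ℝ) (e : ι → V) (f : Fin (n + 1) → ι)
    (i : Fin n) :
    α (fun j => e ((f ∘ Equiv.swap i.castSucc i.succ) j)) = -α (fun j => e (f j)) :=
  α.toAlternatingMap.map_swap (fun j => e (f j)) i.castSucc_lt_succ.ne

theorem push_apply {V W : Type*} [AddCommGroup V] [Module ℝ V] [TopologicalSpace V]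
    [AddCommGroup W] [Module ℝ W] [TopologicalSpace W] {k : ℕ}
    (u : V ≃L[ℝ] W) (α : V [⋀^Fin k]→L[ℝ] ℝ) (v : Fin k → W) :
    push u α v = α (fun i => u.symm (v i)) := rfl

theorem stdVec_eq_basisFun (i : Fin 7) :
    stdVec i = (EuclideanSpace.basisFun (Fin 7) ℝ).toBasis i := by
  simp [stdVec]

theorem sum_smul_stdVec (v : R7) : ∑ i, v i • stdVec i = v := by
  ext j
  simp [stdVec, Finset.sum_apply, Pi.single_apply]

/-- Alternating forms on `ℝ⁷` are determined by their values on increasing tuples of standard basis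
vectors. -/
theorem ext_strictMono {n : ℕ} {α β : R7 [⋀^Fin (n + 1)]→L[ℝ] ℝ}
    (h : ∀ f : Fin (n + 1) → Fin 7, StrictMono f →
      α (fun i => stdVec (f i)) = β (fun i => stdVec (f i))) : α = β := by
  have key := eq_of_eq_strictMono (F := fun f => α fun i => stdVec (f i))
    (G := fun f => β fun i => stdVec (f i)) (alternating_comp_swap α _)
    (alternating_comp_swap β _) h
  apply ContinuousAlternatingMap.toAlternatingMap_injective
  refine Module.Basis.ext_alternating (EuclideanSpace.basisFun (Fin 7) ℝ).toBasis fun f _ => ?_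
  simp only [← stdVec_eq_basisFun]
  exact key f

theorem coordForm_apply {k : ℕ} (s : Fin k → Fin 7) (v : Fin k → R7) :
    coordForm s v = Matrix.det (Matrix.of fun a b => v a (s b)) := rfl

theorem coordForm_stdVec {k : ℕ} (s f : Fin k → Fin 7) :
    coordForm s (fun i => stdVec (f i)) = coordTab k (fun i => s i) (fun i => f i) := by
  induction k with
  | zero => simp [coordForm_apply, coordTab]
  | succ k ih =>
    have e : ∀ j : Fin (k + 1), (Matrix.of fun a b => stdVec (f a) (s b)).submatrix Fin.succ
        j.succAbove = Matrix.of fun a b => stdVec (f a.succ) (s (j.succAbove b)) := fun j => rfl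
    rw [coordForm_apply, Matrix.det_succ_row_zero, coordTab]
    push_cast
    refine Finset.sum_congr rfl fun j _ => ?_
    rw [e, ← coordForm_apply (fun b => s (j.succAbove b)) (fun a => stdVec (f a.succ)), ih]
    by_cases h : f 0 = s j
    · simp [h, stdVec]
    · have h' : (f 0 : ℕ) ≠ s j := fun h'' => h (Fin.ext h'')
      simp [h', stdVec, Ne.symm h]

theorem psi0_stdVec (f : Fin 4 → Fin 7) :
    psi0 (fun i => stdVec (f i)) = psiTab (f 0) (f 1) (f 2) (f 3) := by
  refine eq_of_eq_strictMono (F := fun f => psi0 fun i => stdVec (f i))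
    (G := fun f => (psiTab (f 0) (f 1) (f 2) (f 3) : ℝ)) (alternating_comp_swap psi0 _) ?_ ?_ f
  · intro f i
    have := forall_of_all7 (forall_of_all7 (forall_of_all7 (forall_of_all7 psiTab_antisymm (f 0))
      (f 1)) (f 2)) (f 3)
    simp only [Bool.and_eq_true, beq_iff_eq] at this
    fin_cases i
    · exact_mod_cast this.1.1
    · exact_mod_cast this.1.2
    · exact_mod_cast this.2
  · intro f hf
    have h01 : f 0 < f 1 := hf (by decide)
    have h12 : f 1 < f 2 := hf (by decide)
    have h23 : f 2 < f 3 := hf (by decide)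
    have := forall_of_all7 psiTab_eq_coordTab (f 0)
    have := forall_of_all7 this (f 1)
    rw [Bool.or_eq_true_iff, or_iff_right (by simpa using h01)] at this
    have := forall_of_all7 this (f 2)
    rw [Bool.or_eq_true_iff, or_iff_right (by simpa using h12)] at this
    have := forall_of_all7 this (f 3)
    rw [Bool.or_eq_true_iff, or_iff_right (by simpa using h23), beq_iff_eq] at this
    simp only [psi0, ContinuousAlternatingMap.add_apply, ContinuousAlternatingMap.sub_apply,
      coordForm_stdVec]
    rw [← this]
    push_cast
    have e (g : Fin 4 → Fin 7) : (fun i => (g i : ℕ)) = ![(g 0 : ℕ), g 1, g 2, g 3] := by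
      funext i; fin_cases i <;> rfl
    simp only [e]
    rfl

theorem coordForm_stdVec_of_strictMono {k : ℕ} {s f : Fin k → Fin 7} (hs : StrictMono s)
    (hf : StrictMono f) : coordForm s (fun i => stdVec (f i)) = if f = s then 1 else 0 := by
  rw [coordForm_apply]
  split_ifs with h
  · subst h
    convert Matrix.det_one (n := Fin k) (R := ℝ) using 2
    ext a b
    simp [stdVec, Matrix.one_apply, hs.injective.eq_iff, eq_comm]
  · obtain ⟨a, ha⟩ : ∃ a, f a ∉ Set.range s := by
      by_contra! hcon
      refine h ((StrictMono.range_inj hf hs).1 (Set.eq_of_subset_of_ncard_le ?_ ?_))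
      · rintro _ ⟨a, rfl⟩; exact hcon a
      · rw [← Nat.card_coe_set_eq, ← Nat.card_coe_set_eq,
          Nat.card_range_of_injective hs.injective, Nat.card_range_of_injective hf.injective]
    refine Matrix.det_eq_zero_of_row_eq_zero a fun b => ?_
    have : s b ≠ f a := fun h => ha ⟨b, h⟩
    simp [stdVec, this]

/-- Summing over all tuples counts every increasing one with multiplicity `(n + 1)!`. -/
theorem sum_coordForm_mul {n : ℕ} {F : (Fin (n + 1) → Fin 7) → ℝ}
    (hF : ∀ f (i : Fin n), F (f ∘ Equiv.swap i.castSucc i.succ) = -F f) (s : Fin (n + 1) → Fin 7) :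
    ∑ f : Fin (n + 1) → Fin 7, coordForm s (fun i => stdVec (f i)) * F f
      = (n + 1).factorial * F s := by
  have h1 (f : Fin (n + 1) → Fin 7) (σ : Equiv.Perm (Fin (n + 1))) :
      ∏ i, (stdVec (f (σ i)) : R7) (s i) = if f = s ∘ σ.symm then 1 else 0 := by
    have e : (f = s ∘ σ.symm) ↔ ∀ i, s i = f (σ i) := by
      constructor
      · rintro rfl i; simp
      · intro h; funext i; simp [h]
    simp only [stdVec, PiLp.single_apply, e, Finset.prod_ite_zero]
    simp
  simp only [coordForm_apply, Matrix.det_apply, Matrix.of_apply, h1, Finset.sum_mul]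
  rw [Finset.sum_comm]
  have h2 (σ : Equiv.Perm (Fin (n + 1))) : ∑ f : Fin (n + 1) → Fin 7,
      (Equiv.Perm.sign σ • (if f = s ∘ σ.symm then (1 : ℝ) else 0)) * F f = F s := by
    have h3 : F (s ∘ σ.symm) = (Equiv.Perm.sign σ : ℤ) * F s := by
      rw [apply_comp_perm hF, Equiv.Perm.sign_symm]
    simp only [smul_ite, smul_zero, ite_mul, zero_mul, Finset.sum_ite_eq',
      Finset.mem_univ, if_true, h3]
    rcases Int.units_eq_one_or (Equiv.Perm.sign σ) with h | h <;> simp [h]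
  rw [Finset.sum_congr rfl fun σ _ => h2 σ]
  simp [Fintype.card_perm]

/-! ### The model three-form -/

/-- The model `3`-form `φ₀ = *ψ₀`. -/
def phi0 : R7 [⋀^Fin 3]→L[ℝ] ℝ := hodgeStar0 psi0

theorem curryLeft_vol0 (a b c d : R7) (v : Fin 3 → R7) :
    ((((vol0.curryLeft a).curryLeft b).curryLeft c).curryLeft d) v
      = vol0 ![a, b, c, d, v 0, v 1, v 2] := by
  simp only [ContinuousAlternatingMap.curryLeft_apply_apply]
  congr 1
  funext i; fin_cases i <;> rfl

theorem hodgeStar0_coordForm {r : Fin 4 → Fin 7} (hr : StrictMono r) (v : Fin 3 → R7) :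
    hodgeStar0 (coordForm r) v
      = vol0 ![stdVec (r 0), stdVec (r 1), stdVec (r 2), stdVec (r 3), v 0, v 1, v 2] := by
  rw [hodgeStar0, ContinuousAlternatingMap.sum_apply,
    Finset.sum_eq_single (OrderEmbedding.ofStrictMono r hr)]
  · rw [ContinuousAlternatingMap.smul_apply, curryLeft_vol0]
    simp [coordForm_stdVec_of_strictMono hr hr]
  · intro s _ hs
    have : (s : Fin 4 → Fin 7) ≠ r := by
      rintro rfl; exact hs (by ext; rfl)
    rw [coordForm_stdVec_of_strictMono hr s.strictMono, if_neg this, zero_smul]; rfl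
  · simp

theorem hodgeStar0_add (α β : R7 [⋀^Fin 4]→L[ℝ] ℝ) :
    hodgeStar0 (α + β) = hodgeStar0 α + hodgeStar0 β := by
  simp [hodgeStar0, add_smul, Finset.sum_add_distrib]

theorem hodgeStar0_sub (α β : R7 [⋀^Fin 4]→L[ℝ] ℝ) :
    hodgeStar0 (α - β) = hodgeStar0 α - hodgeStar0 β := by
  simp [hodgeStar0, sub_smul, Finset.sum_sub_distrib]

theorem phi0_apply (v : Fin 3 → R7) :
    let B (a b c d : Fin 7) :=
      vol0 ![stdVec a, stdVec b, stdVec c, stdVec d, v 0, v 1, v 2]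
    phi0 v = B 1 2 3 4 + B 1 2 5 6 + B 3 4 5 6 - B 0 1 3 6 + B 0 2 4 6 - B 0 2 3 5 - B 0 1 4 5 := by
  have h1 : StrictMono (![1, 2, 3, 4] : Fin 4 → Fin 7) := by decide
  have h2 : StrictMono (![1, 2, 5, 6] : Fin 4 → Fin 7) := by decide
  have h3 : StrictMono (![3, 4, 5, 6] : Fin 4 → Fin 7) := by decide
  have h4 : StrictMono (![0, 1, 3, 6] : Fin 4 → Fin 7) := by decide
  have h5 : StrictMono (![0, 2, 4, 6] : Fin 4 → Fin 7) := by decide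
  have h6 : StrictMono (![0, 2, 3, 5] : Fin 4 → Fin 7) := by decide
  have h7 : StrictMono (![0, 1, 4, 5] : Fin 4 → Fin 7) := by decide
  simp only [phi0, psi0, hodgeStar0_add, hodgeStar0_sub, ContinuousAlternatingMap.add_apply,
    ContinuousAlternatingMap.sub_apply, hodgeStar0_coordForm h1, hodgeStar0_coordForm h2,
    hodgeStar0_coordForm h3, hodgeStar0_coordForm h4, hodgeStar0_coordForm h5,
    hodgeStar0_coordForm h6, hodgeStar0_coordForm h7]
  rfl

theorem phi0_stdVec (f : Fin 3 → Fin 7) :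
    phi0 (fun i => stdVec (f i)) = phiTab (f 0) (f 1) (f 2) := by
  refine eq_of_eq_strictMono (F := fun f => phi0 fun i => stdVec (f i))
    (G := fun f => (phiTab (f 0) (f 1) (f 2) : ℝ)) (alternating_comp_swap phi0 _) ?_ ?_ f
  · intro f i
    have := forall_of_all7 (forall_of_all7 (forall_of_all7 phiTab_antisymm (f 0)) (f 1)) (f 2)
    simp only [Bool.and_eq_true, beq_iff_eq] at this
    fin_cases i
    · exact_mod_cast this.1
    · exact_mod_cast this.2
  · intro f hf
    have h01 : f 0 < f 1 := hf (by decide)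
    have h12 : f 1 < f 2 := hf (by decide)
    have := forall_of_all7 phiTab_eq_coordTab (f 0)
    have := forall_of_all7 this (f 1)
    rw [Bool.or_eq_true_iff, or_iff_right (by simpa using h01)] at this
    have := forall_of_all7 this (f 2)
    rw [Bool.or_eq_true_iff, or_iff_right (by simpa using h12), beq_iff_eq] at this
    have e (a b c d : Fin 7) : vol0 ![stdVec a, stdVec b, stdVec c, stdVec d, stdVec (f 0),
        stdVec (f 1), stdVec (f 2)]
        = coordTab 7 ![0, 1, 2, 3, 4, 5, 6] ![(a : ℕ), b, c, d, f 0, f 1, f 2] := by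
      have h := coordForm_stdVec id ![a, b, c, d, f 0, f 1, f 2]
      have h1 : (fun i => stdVec (![a, b, c, d, f 0, f 1, f 2] i)) = ![stdVec a, stdVec b, stdVec c,
        stdVec d, stdVec (f 0), stdVec (f 1), stdVec (f 2)] := by
        funext i; fin_cases i <;> rfl
      have h2 : (fun i => ((![a, b, c, d, f 0, f 1, f 2] : Fin 7 → Fin 7) i : ℕ))
          = ![(a : ℕ), b, c, d, f 0, f 1, f 2] := by
        funext i; fin_cases i <;> rfl
      have h3 : (fun i : Fin 7 => ((id i : Fin 7) : ℕ)) = ![0, 1, 2, 3, 4, 5, 6] := by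
        funext i; fin_cases i <;> rfl
      rw [h1, h2, h3] at h
      exact h
    simp only [phi0_apply, e]
    rw [← this]
    push_cast
    rfl

/-- The Hodge star as a sum over all tuples. Unlike the sum over increasing tuples it is manifestly
invariant under rotations. -/
theorem sum_psi0_mul_vol0 (v : Fin 3 → R7) :
    ∑ f : Fin 4 → Fin 7, psi0 (fun i => stdVec (f i)) *
      vol0 ![stdVec (f 0), stdVec (f 1), stdVec (f 2), stdVec (f 3), v 0, v 1, v 2]
        = 24 * phi0 v := by
  have hF : ∀ (f : Fin 4 → Fin 7) (i : Fin 3),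
      (fun f : Fin 4 → Fin 7 => vol0 ![stdVec (f 0), stdVec (f 1), stdVec (f 2), stdVec (f 3), v 0,
        v 1, v 2]) (f ∘ Equiv.swap i.castSucc i.succ)
      = -(fun f : Fin 4 → Fin 7 => vol0 ![stdVec (f 0), stdVec (f 1), stdVec (f 2), stdVec (f 3),
        v 0, v 1, v 2]) f := by
    intro f i
    have key (a b : Fin 7) (hab : a ≠ b) := vol0.toAlternatingMap.map_swap ![stdVec (f 0),
      stdVec (f 1), stdVec (f 2), stdVec (f 3), v 0, v 1, v 2] hab
    fin_cases i
    · refine Eq.trans (congrArg vol0 ?_) (key 0 1 (by decide))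
      funext j; fin_cases j <;> rfl
    · refine Eq.trans (congrArg vol0 ?_) (key 1 2 (by decide))
      funext j; fin_cases j <;> rfl
    · refine Eq.trans (congrArg vol0 ?_) (key 2 3 (by decide))
      funext j; fin_cases j <;> rfl
  have hS (s : Fin 4 → Fin 7) : ∑ f : Fin 4 → Fin 7, coordForm s (fun i => stdVec (f i)) *
      vol0 ![stdVec (f 0), stdVec (f 1), stdVec (f 2), stdVec (f 3), v 0, v 1, v 2]
      = 24 * vol0 ![stdVec (s 0), stdVec (s 1), stdVec (s 2), stdVec (s 3), v 0, v 1, v 2] := by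
    refine (sum_coordForm_mul (n := 3) hF s).trans ?_
    simp [Nat.factorial]
  simp only [psi0, ContinuousAlternatingMap.add_apply, ContinuousAlternatingMap.sub_apply, add_mul,
    sub_mul, Finset.sum_add_distrib, Finset.sum_sub_distrib, hS, phi0_apply]
  simp
  ring

theorem sum_fin_succ_arrow {n : ℕ} (G : (Fin (n + 1) → Fin 7) → ℝ) :
    ∑ f, G f = ∑ a, ∑ f : Fin n → Fin 7, G (Matrix.vecCons a f) := by
  rw [← Fintype.sum_prod_type']
  exact ((Fin.consEquiv fun _ => Fin 7).sum_comp G).symm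

theorem apply_eq_sum {n : ℕ} (α : MultilinearMap ℝ (fun _ : Fin n => R7) ℝ) (v : Fin n → R7) :
    α v = ∑ f : Fin n → Fin 7, (∏ i, v i (f i)) * α (fun i => stdVec (f i)) := by
  conv_lhs => rw [show v = fun i => ∑ j, v i j • stdVec j from
    funext fun i => (sum_smul_stdVec (v i)).symm]
  rw [MultilinearMap.map_sum]
  exact Finset.sum_congr rfl fun f _ => by rw [MultilinearMap.map_smul_univ, smul_eq_mul]

theorem psi0_apply (v : Fin 4 → R7) : psi0 v = ∑ a : Fin 7, ∑ b : Fin 7, ∑ c : Fin 7, ∑ d : Fin 7,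
    v 0 a * v 1 b * v 2 c * v 3 d * psiTab a b c d := by
  have := apply_eq_sum psi0.toMultilinearMap v
  refine this.trans ?_
  simp only [sum_fin_succ_arrow]
  simp [Fin.prod_univ_four, psi0_stdVec]

/-! ### The stabiliser of the model four-form is orthogonal -/

section Stabiliser

open Matrix Kronecker

/-- The matrix of the bilinear form on `ℝ⁷ ⊗ ℝ⁷` defined by `ψ₀`. -/
def psiMat : Matrix (Fin 7 × Fin 7) (Fin 7 × Fin 7) ℝ :=
  of fun x y => psiTab x.1 x.2 y.1 y.2

/-- Twice the projection of `ℝ⁷ ⊗ ℝ⁷` onto the antisymmetric tensors. -/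
def altMat : Matrix (Fin 7 × Fin 7) (Fin 7 × Fin 7) ℝ :=
  of fun x y => (1 : Matrix _ _ ℝ) x y - (1 : Matrix _ _ ℝ) x.swap y

theorem psiTab_contract' (a b e f : Fin 7) :
    ∑ c : Fin 7, ∑ d : Fin 7, psiTab a b c d * psiTab c d e f =
      4 * ((if a = e ∧ b = f then 1 else 0) - (if a = f ∧ b = e then 1 else 0))
        + 2 * psiTab a b e f := by
  have := forall_of_all7 (forall_of_all7 (forall_of_all7 (forall_of_all7 psiTab_contract a) b) e) f
  simp only [sum7_eq, beq_iff_eq] at this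
  rw [this]
  simp [Bool.cond_eq_ite, Fin.ext_iff]

theorem altMat_mul (A : Matrix (Fin 7 × Fin 7) (Fin 7 × Fin 7) ℝ) (x y) :
    (altMat * A) x y = A x y - A x.swap y := by
  simp [mul_apply, altMat, sub_mul, Finset.sum_sub_distrib, one_apply]

theorem mul_altMat (A : Matrix (Fin 7 × Fin 7) (Fin 7 × Fin 7) ℝ) (x y) :
    (A * altMat) x y = A x y - A x y.swap := by
  have (z : Fin 7 × Fin 7) : z.swap = y ↔ z = y.swap := Prod.swap_eq_iff_eq_swap
  simp [mul_apply, altMat, mul_sub, Finset.sum_sub_distrib, one_apply, this]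

theorem altMat_comm (A : Matrix (Fin 7) (Fin 7) ℝ) : altMat * (A ⊗ₖ A) = (A ⊗ₖ A) * altMat := by
  ext ⟨a, b⟩ ⟨c, d⟩
  simp only [altMat_mul, mul_altMat, Prod.swap, kronecker_apply]
  ring

theorem psiTab_swap_left (a b c d : Fin 7) : psiTab b a c d = -psiTab a b c d := by
  have := forall_of_all7 (forall_of_all7 (forall_of_all7 (forall_of_all7 psiTab_antisymm a) b) c) d
  simp only [Bool.and_eq_true, beq_iff_eq] at this
  exact this.1.1

theorem psiTab_swap_right (a b c d : Fin 7) : psiTab a b d c = -psiTab a b c d := by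
  have := forall_of_all7 (forall_of_all7 (forall_of_all7 (forall_of_all7 psiTab_antisymm a) b) c) d
  simp only [Bool.and_eq_true, beq_iff_eq] at this
  exact this.2

theorem altMat_mul_psiMat : altMat * psiMat = (2 : ℝ) • psiMat := by
  ext ⟨a, b⟩ ⟨c, d⟩
  simp only [altMat_mul, psiMat, of_apply, Prod.swap, Matrix.smul_apply, smul_eq_mul,
    psiTab_swap_left a b]
  push_cast; ring

theorem psiMat_mul_altMat : psiMat * altMat = (2 : ℝ) • psiMat := by
  ext ⟨a, b⟩ ⟨c, d⟩
  simp only [mul_altMat, psiMat, of_apply, Prod.swap, Matrix.smul_apply, smul_eq_mul,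
    psiTab_swap_right a b c d]
  push_cast; ring

theorem altMat_mul_altMat : altMat * altMat = (2 : ℝ) • altMat := by
  ext x y
  have e : altMat x.swap y = -altMat x y := by
    change (1 : Matrix (Fin 7 × Fin 7) (Fin 7 × Fin 7) ℝ) x.swap y
      - (1 : Matrix (Fin 7 × Fin 7) (Fin 7 × Fin 7) ℝ) x y = -altMat x y
    rw [altMat, of_apply]; ring
  rw [altMat_mul, e, Matrix.smul_apply, smul_eq_mul]
  ring

theorem psiMat_mul_psiMat : psiMat * psiMat = (4 : ℝ) • altMat + (2 : ℝ) • psiMat := by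
  ext ⟨a, b⟩ ⟨e, f⟩
  have := congrArg (Int.cast (R := ℝ)) (psiTab_contract' a b e f)
  push_cast at this
  simp only [mul_apply, Fintype.sum_prod_type, psiMat, of_apply, this, Matrix.add_apply,
    Matrix.smul_apply, smul_eq_mul, altMat, one_apply, Prod.swap, Prod.mk.injEq]
  simp only [and_comm]

/-- Conjugating `psiMat` by `A ⊗ A` evaluates `ψ₀` on the rows of `A`. -/
theorem kronecker_conj_psiMat (A : Matrix (Fin 7) (Fin 7) ℝ) (a b c d : Fin 7) :
    ((A ⊗ₖ A) * psiMat * (A ⊗ₖ A)ᵀ) (a, b) (c, d) = psi0 ![WithLp.toLp 2 (A a),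
      WithLp.toLp 2 (A b), WithLp.toLp 2 (A c), WithLp.toLp 2 (A d)] := by
  have h : ((A ⊗ₖ A) * psiMat * (A ⊗ₖ A)ᵀ) (a, b) (c, d) = ∑ x : Fin 7 × Fin 7,
      ∑ y : Fin 7 × Fin 7, A a x.1 * A b x.2 * A c y.1 * A d y.2 * psiTab x.1 x.2 y.1 y.2 := by
    rw [Finset.sum_comm]
    simp only [mul_apply, kroneckerMap_apply, transpose_apply, Finset.sum_mul, psiMat, of_apply]
    exact Finset.sum_congr rfl fun y _ => Finset.sum_congr rfl fun x _ => by ring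
  rw [h, psi0_apply]
  simp only [Fintype.sum_prod_type]
  rfl

/-- A symmetric matrix with nonnegative diagonal which induces the identity on bivectors is the
identity; only the components with one repeated index are needed. -/
theorem eq_one_of_minors {H : Matrix (Fin 7) (Fin 7) ℝ} (hs : ∀ a b, H a b = H b a)
    (hp : ∀ a, 0 ≤ H a a)
    (h : ∀ a b d, H a d * H b b - H a b * H b d = (1 : Matrix (Fin 7) (Fin 7) ℝ) a d
      - (1 : Matrix (Fin 7) (Fin 7) ℝ) a b * (1 : Matrix (Fin 7) (Fin 7) ℝ) b d) : H = 1 := by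
  have hd (a b : Fin 7) (hab : a ≠ b) : H a a * H b b - H a b * H a b = 1 := by
    have := h a b a
    rw [hs b a] at this
    simpa [hab] using this
  have ho (a d : Fin 7) (had : a ≠ d) : H a d = 0 := by
    obtain ⟨b, hba, hbd⟩ : ∃ b : Fin 7, b ≠ a ∧ b ≠ d := by decide +revert
    have h1 := h a b d
    have h2 := h a d b
    simp only [one_apply_ne hba.symm, one_apply_ne had, zero_mul, sub_zero] at h1 h2
    have h3 := hd b d hbd
    rw [hs d b] at h2
    linear_combination (-H a d) * h3 + H d d * h1 + H b d * h2
  have h1 (a : Fin 7) : H a a = 1 := by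
    obtain ⟨b, c, hab, hac, hbc⟩ : ∃ b c : Fin 7, a ≠ b ∧ a ≠ c ∧ b ≠ c := by decide +revert
    have e1 := hd a b hab
    have e2 := hd a c hac
    have e3 := hd b c hbc
    rw [ho _ _ hab] at e1
    rw [ho _ _ hac] at e2
    rw [ho _ _ hbc] at e3
    have : H a a * H a a = 1 := by
      linear_combination (H a a * H c c) * e1 + e2 - (H a a * H a a) * e3
    nlinarith [hp a]
  ext a d
  by_cases had : a = d
  · subst had; simp [h1]
  · rw [ho _ _ had, one_apply_ne had]

/-- The stabiliser of `ψ₀` in `GL(7, ℝ)` consists of orthogonal maps. On `Λ²` the form `ψ₀`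
satisfies a quadratic equation, so its inverse is a combination of `ψ₀` and of the Euclidean metric
of `Λ²`; invariance of the inverse, antisymmetrised, gives that of the metric. -/
theorem inner_eq_of_psi0_invariant {u : R7 ≃L[ℝ] R7} (hu : ∀ v, psi0 (fun i => u (v i)) = psi0 v)
    (x y : R7) : inner ℝ (u x) (u y) = inner ℝ x y := by
  set U : Matrix (Fin 7) (Fin 7) ℝ := of fun i j => u (stdVec j) i
  set V : Matrix (Fin 7) (Fin 7) ℝ := of fun i j => u.symm (stdVec j) i
  have happ (w : R7 ≃L[ℝ] R7) (z : R7) (i : Fin 7) :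
      w z i = ∑ j, w (stdVec j) i * z j := by
    conv_lhs => rw [← sum_smul_stdVec z]
    simp [map_sum, mul_comm]
  have hUV : U * V = 1 := by
    ext i j
    rw [mul_apply]
    refine (happ u (u.symm (stdVec j)) i).symm.trans ?_
    simp [stdVec, one_apply]
  have hVU : V * U = 1 := mul_eq_one_comm.1 hUV
  set K := U ⊗ₖ U with hK
  set L := V ⊗ₖ V with hL
  have hLK : L * K = 1 := by rw [hL, hK, ← mul_kronecker_mul, hVU, one_kronecker_one]
  have hKL : K * L = 1 := mul_eq_one_comm.1 hLK
  have hKt : Kᵀ * Lᵀ = 1 := by rw [← transpose_mul, hLK, transpose_one]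
  have hPL : altMat * L = L * altMat := altMat_comm V
  have hPKt : altMat * Kᵀ = Kᵀ * altMat := altMat_comm Uᵀ
  have hN : Kᵀ * psiMat * K = psiMat := by
    ext ⟨a, b⟩ ⟨c, d⟩
    have := kronecker_conj_psiMat Uᵀ a b c d
    have e : (Uᵀ ⊗ₖ Uᵀ)ᵀ = K := rfl
    rw [e] at this
    refine this.trans ?_
    have h4 := hu ![stdVec a, stdVec b, stdVec c, stdVec d]
    have h5 := psi0_stdVec ![a, b, c, d]
    have e2 : (fun i => stdVec (![a, b, c, d] i)) = ![stdVec a, stdVec b, stdVec c, stdVec d] := by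
      funext i; fin_cases i <;> rfl
    rw [e2] at h5
    refine Eq.trans (congrArg psi0 ?_) (h4.trans h5)
    funext i; fin_cases i <;> rfl
  -- `Q` is a multiple of the inverse of `psiMat` on the antisymmetric tensors
  set Q := psiMat - altMat with hQ
  have hNQ : psiMat * Q = (4 : ℝ) • altMat := by
    rw [hQ, mul_sub, psiMat_mul_psiMat, psiMat_mul_altMat]; abel
  have hQN : Q * psiMat = (4 : ℝ) • altMat := by
    rw [hQ, sub_mul, psiMat_mul_psiMat, altMat_mul_psiMat]; abel
  have hPQ : altMat * Q = (2 : ℝ) • Q := by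
    rw [hQ, mul_sub, altMat_mul_psiMat, altMat_mul_altMat, smul_sub]
  have hQP : Q * altMat = (2 : ℝ) • Q := by
    rw [hQ, sub_mul, psiMat_mul_altMat, altMat_mul_altMat, smul_sub]
  have hNM : psiMat * (L * Q * Lᵀ) = (4 : ℝ) • altMat := by
    calc psiMat * (L * Q * Lᵀ) = Kᵀ * psiMat * (K * L) * Q * Lᵀ := by
          conv_lhs => rw [← hN]
          simp only [Matrix.mul_assoc]
      _ = Kᵀ * (psiMat * Q) * Lᵀ := by rw [hKL]; simp only [Matrix.mul_assoc, Matrix.one_mul]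
      _ = (4 : ℝ) • altMat := by
          rw [hNQ, Matrix.mul_smul, Matrix.smul_mul, ← hPKt, Matrix.mul_assoc, hKt, Matrix.mul_one]
  have hM : L * Q * Lᵀ = Q := by
    have h1 : Q * psiMat * (L * Q * Lᵀ) = (8 : ℝ) • (L * Q * Lᵀ) := by
      rw [hQN, Matrix.smul_mul, ← Matrix.mul_assoc, ← Matrix.mul_assoc, hPL,
        Matrix.mul_assoc L, hPQ, Matrix.mul_smul, Matrix.smul_mul, smul_smul]
      norm_num
    have h2 : Q * psiMat * (L * Q * Lᵀ) = (8 : ℝ) • Q := by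
      rw [Matrix.mul_assoc, hNM, Matrix.mul_smul, hQP, smul_smul]; norm_num
    exact smul_right_injective _ (by norm_num : (8 : ℝ) ≠ 0) (h1.symm.trans h2)
  -- The components of `L * Q * Lᵀ = Q` with a repeated middle index contain no `ψ₀`.
  have hH : V * Vᵀ = 1 := by
    refine eq_one_of_minors (fun a b => ?_) (fun a => ?_) fun a b d => ?_
    · simp [mul_apply, mul_comm]
    · rw [mul_apply]
      exact Finset.sum_nonneg fun i _ => by simpa using mul_self_nonneg (V a i)
    · have h1 : L * psiMat * Lᵀ - altMat * ((V * Vᵀ) ⊗ₖ (V * Vᵀ)) = psiMat - altMat := by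
        rw [mul_kronecker_mul, ← Matrix.mul_assoc]
        change L * psiMat * Lᵀ - altMat * L * Lᵀ = Q
        rw [hPL, ← Matrix.sub_mul, ← Matrix.mul_sub]
        exact hM
      have h2 := congrFun (congrFun h1 (a, b)) (b, d)
      have h3 : (L * psiMat * Lᵀ) (a, b) (b, d) = 0 := by
        rw [kronecker_conj_psiMat]
        exact psi0.map_eq_zero_of_eq _ (i := 1) (j := 2) rfl (by decide)
      have h4 : psiTab a b b d = 0 := by
        have := psi0_stdVec ![a, b, b, d]
        rw [psi0.map_eq_zero_of_eq _ (i := 1) (j := 2) rfl (by decide)] at this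
        exact_mod_cast this.symm
      have h5 : (psiMat (a, b) (b, d) : ℝ) = 0 := by simp [psiMat, h4]
      simp only [Matrix.sub_apply, h3, h5, altMat_mul, kronecker_apply, Prod.swap] at h2
      simp only [altMat, of_apply, one_apply, Prod.swap, Prod.mk.injEq] at h2
      simp only [one_apply]
      have e1 : (if a = b ∧ b = d then (1 : ℝ) else 0)
          = (if a = b then 1 else 0) * (if b = d then 1 else 0) := by
        rw [ite_and, ite_mul, one_mul, zero_mul]
      simp only [e1, true_and] at h2
      linarith
  have hUt : Uᵀ * U = 1 := by
    have : V = Uᵀ := by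
      have h1 : Vᵀ * Uᵀ = 1 := by rw [← transpose_mul, hUV, transpose_one]
      calc V = V * (Vᵀ * Uᵀ) := by rw [h1, Matrix.mul_one]
        _ = Uᵀ := by rw [← Matrix.mul_assoc, hH, Matrix.one_mul]
    rw [← this, hVU]
  have hx (z : R7) : (u z).ofLp = U *ᵥ z.ofLp := by
    funext i; rw [happ]; rfl
  simp only [EuclideanSpace.inner_eq_star_dotProduct, star_trivial, hx]
  rw [dotProduct_mulVec, vecMul_mulVec, hUt]
  simp

end Stabiliser

/-! ### Invariance of the model three-form -/

theorem inner_stdVec (i j : Fin 7) :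
    inner ℝ (stdVec i) (stdVec j) = if i = j then (1 : ℝ) else 0 := by
  rw [stdVec_eq_basisFun, stdVec_eq_basisFun]
  simp only [OrthonormalBasis.coe_toBasis]
  exact (EuclideanSpace.basisFun (Fin 7) ℝ).inner_eq_ite i j

theorem inner_stdVec_right (x : R7) (i : Fin 7) : inner ℝ x (stdVec i) = x i := by
  have := EuclideanSpace.inner_single_right (𝕜 := ℝ) i (1 : ℝ) x
  rw [one_mul] at this
  exact this

theorem vol0_stdVec : vol0 (fun i => stdVec i) = 1 := by
  have := coordForm_stdVec_of_strictMono (s := id) (f := id) (k := 7) strictMono_id strictMono_id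
  rwa [if_pos rfl] at this

/-- Every `7`-form on `ℝ⁷` is a multiple of the volume form. -/
theorem top_form_apply (α : R7 [⋀^Fin 7]→L[ℝ] ℝ) (v : Fin 7 → R7) :
    α v = α (fun i => stdVec i) * vol0 v := by
  set b := (EuclideanSpace.basisFun (Fin 7) ℝ).toBasis
  have hb : (b : Fin 7 → R7) = fun i => stdVec i := funext fun i => (stdVec_eq_basisFun i).symm
  have h (γ : R7 [⋀^Fin 7]→L[ℝ] ℝ) (w : Fin 7 → R7) :
      γ w = γ (fun i => stdVec i) * b.det w := by
    have := congrArg (fun δ => δ w) (AlternatingMap.eq_smul_basis_det b γ.toAlternatingMap)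
    rw [hb] at this
    exact this
  have h1 := h vol0 v
  rw [vol0_stdVec, one_mul] at h1
  rw [h, h1]

theorem sum_orthogonal_rows {u : R7 ≃L[ℝ] R7} (hu : ∀ x y, inner ℝ (u x) (u y) = inner ℝ x y)
    (i j : Fin 7) : ∑ k, u (stdVec k) i * u (stdVec k) j = if i = j then 1 else 0 := by
  set U : Matrix (Fin 7) (Fin 7) ℝ := Matrix.of fun i j => u (stdVec j) i with hU
  have h : U.transpose * U = 1 := by
    ext a b
    have := hu (stdVec a) (stdVec b)
    rw [inner_stdVec, PiLp.inner_apply] at this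
    simpa [Matrix.mul_apply, hU, Matrix.one_apply, mul_comm] using this
  have h1 : U * U.transpose = 1 := mul_eq_one_comm.1 h
  have h2 := congrFun (congrFun h1 i) j
  simpa [Matrix.mul_apply, hU, Matrix.one_apply] using h2

theorem vol0_eq_one_of_isometry {u : R7 ≃L[ℝ] R7}
    (hu : ∀ x y, inner ℝ (u x) (u y) = inner ℝ x y) (hpos : 0 < vol0 (fun i => u (stdVec i))) :
    vol0 (fun i => u (stdVec i)) = 1 := by
  set U : Matrix (Fin 7) (Fin 7) ℝ := Matrix.of fun i j => u (stdVec j) i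
  have h : U * U.transpose = 1 := by
    ext i j
    rw [Matrix.mul_apply, Matrix.one_apply]
    exact sum_orthogonal_rows hu i j
  have hd : vol0 (fun i => u (stdVec i)) = U.transpose.det :=
    (coordForm_apply id _).trans (congrArg Matrix.det (by ext i j; rfl))
  have h2 := congrArg Matrix.det h
  rw [Matrix.det_mul, Matrix.det_one, Matrix.det_transpose] at h2
  rw [hd, Matrix.det_transpose] at hpos ⊢
  nlinarith

/-- The inner product of tensors does not depend on the orthonormal basis. -/
theorem sum_mul_isometry {n : ℕ} {u : R7 ≃L[ℝ] R7}
    (hu : ∀ x y, inner ℝ (u x) (u y) = inner ℝ x y)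
    (α β : MultilinearMap ℝ (fun _ : Fin n => R7) ℝ) :
    ∑ f : Fin n → Fin 7, α (fun i => u (stdVec (f i))) * β (fun i => u (stdVec (f i)))
      = ∑ f : Fin n → Fin 7, α (fun i => stdVec (f i)) * β (fun i => stdVec (f i)) := by
  have h1 (f : Fin n → Fin 7) :
      α (fun i => u (stdVec (f i))) * β (fun i => u (stdVec (f i)))
      = ∑ g : Fin n → Fin 7, ∑ h : Fin n → Fin 7,
        (∏ i, (u (stdVec (f i)) (g i) * u (stdVec (f i)) (h i))) *
          (α (fun i => stdVec (g i)) * β (fun i => stdVec (h i))) := by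
    rw [apply_eq_sum α, apply_eq_sum β, Finset.sum_mul_sum]
    refine Finset.sum_congr rfl fun g _ => Finset.sum_congr rfl fun h _ => ?_
    rw [Finset.prod_mul_distrib]; ring
  have h2 (g h : Fin n → Fin 7) :
      ∑ f : Fin n → Fin 7, ∏ i, (u (stdVec (f i)) (g i) * u (stdVec (f i)) (h i))
        = if g = h then 1 else 0 := by
    rw [← Fintype.piFinset_univ, ← Finset.prod_univ_sum (fun _ => Finset.univ)
      (fun i k => u (stdVec k) (g i) * u (stdVec k) (h i))]
    simp only [sum_orthogonal_rows hu, Finset.prod_ite_zero, Finset.prod_const_one, funext_iff,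
      Finset.mem_univ, true_imp_iff]
  simp only [h1]
  rw [Finset.sum_comm]
  refine Finset.sum_congr rfl fun g _ => ?_
  rw [Finset.sum_comm]
  simp only [← Finset.sum_mul, h2]
  simp

/-- A `7`-form with its last three arguments fixed, as a multilinear map. -/
def contractLast (α : R7 [⋀^Fin 7]→L[ℝ] ℝ) (w : Fin 3 → R7) :
    MultilinearMap ℝ (fun _ : Fin 4 => R7) ℝ :=
  (α.toMultilinearMap.domDomCongr
    (finSumFinEquiv.symm.trans (Equiv.sumComm (Fin 4) (Fin 3)))).currySum w

theorem contractLast_apply (α : R7 [⋀^Fin 7]→L[ℝ] ℝ) (w : Fin 3 → R7) (x : Fin 4 → R7) :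
    contractLast α w x = α ![x 0, x 1, x 2, x 3, w 0, w 1, w 2] := by
  refine congrArg α ?_
  funext i; fin_cases i <;> rfl

/-- The stabiliser of `ψ₀` in `GL⁺(7, ℝ)` fixes `φ₀`. -/
theorem phi0_invariant {u : R7 ≃L[ℝ] R7} (hu : ∀ v, psi0 (fun i => u (v i)) = psi0 v)
    (hpos : 0 < vol0 (fun i => u (stdVec i))) (v : Fin 3 → R7) :
    phi0 (fun i => u (v i)) = phi0 v := by
  have hiso := inner_eq_of_psi0_invariant hu
  have hvol (w : Fin 7 → R7) : vol0 (fun i => u (w i)) = vol0 w := by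
    have := top_form_apply (vol0.compContinuousLinearMap (u : R7 →L[ℝ] R7)) w
    simp only [ContinuousAlternatingMap.compContinuousLinearMap_apply] at this
    rw [show (⇑(u : R7 →L[ℝ] R7) ∘ fun i => stdVec i) = fun i => u (stdVec i) from rfl,
      vol0_eq_one_of_isometry hiso hpos, one_mul] at this
    exact this
  have h1 := sum_psi0_mul_vol0 (fun i => u (v i))
  have h2 := sum_psi0_mul_vol0 v
  have h3 := sum_mul_isometry hiso psi0.toMultilinearMap
    (contractLast vol0 fun i => u (v i))
  simp only [contractLast_apply] at h3
  change ∑ f : Fin 4 → Fin 7, psi0 (fun i => u (stdVec (f i))) * _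
    = ∑ f : Fin 4 → Fin 7, psi0 (fun i => stdVec (f i)) * _ at h3
  rw [h1] at h3
  have h4 (f : Fin 4 → Fin 7) : vol0 ![u (stdVec (f 0)), u (stdVec (f 1)), u (stdVec (f 2)),
      u (stdVec (f 3)), u (v 0), u (v 1), u (v 2)]
      = vol0 ![stdVec (f 0), stdVec (f 1), stdVec (f 2), stdVec (f 3), v 0, v 1, v 2] := by
    refine Eq.trans (congrArg vol0 ?_) (hvol ![stdVec (f 0), stdVec (f 1), stdVec (f 2),
      stdVec (f 3), v 0, v 1, v 2])
    funext i; fin_cases i <;> rfl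
  simp only [hu, h4, h2] at h3
  linarith

/-! ### The infinitesimal action on forms -/

/-- The derivation `α ↦ ∑ᵢ α(…, B ·, …)` of forms defined by an endomorphism `B`. It is minus the
derivative at `0` of `exp(sB)α`. -/
def derivAct {k : ℕ} (α : R7 [⋀^Fin k]→L[ℝ] ℝ) (B : R7 →L[ℝ] R7) : R7 [⋀^Fin k]→L[ℝ] ℝ :=
  α.fderivCompContinuousLinearMap (ContinuousLinearMap.id ℝ R7) B

theorem fderivComp_apply {k : ℕ} (α : R7 [⋀^Fin k]→L[ℝ] ℝ) (A B : R7 →L[ℝ] R7)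
    (v : Fin k → R7) : α.fderivCompContinuousLinearMap A B v
      = ∑ i, α (Function.update (fun j => A (v j)) i (B (v i))) := by
  rw [ContinuousAlternatingMap.fderivCompContinuousLinearMap_apply]
  refine Finset.sum_congr rfl fun i _ => congrArg α (funext fun j => ?_)
  by_cases h : j = i
  · subst h; simp
  · simp [h]

theorem derivAct_apply {k : ℕ} (α : R7 [⋀^Fin k]→L[ℝ] ℝ) (B : R7 →L[ℝ] R7) (v : Fin k → R7) :
    derivAct α B v = ∑ i, α (Function.update v i (B (v i))) :=
  fderivComp_apply α _ B v

theorem derivAct_stdVec {k : ℕ} (α : R7 [⋀^Fin k]→L[ℝ] ℝ) (B : R7 →L[ℝ] R7) (f : Fin k → Fin 7) :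
    derivAct α B (fun i => stdVec (f i)) = ∑ m, ∑ i, B (stdVec (f i)) m *
      α (fun j => stdVec (Function.update f i m j)) := by
  rw [derivAct_apply, Finset.sum_comm]
  refine Finset.sum_congr rfl fun i _ => ?_
  rw [← sum_smul_stdVec (B (stdVec (f i)))]
  have h := α.toMultilinearMap.map_update_sum (t := Finset.univ) (i := i)
    (g := fun m => (B (stdVec (f i))) m • stdVec m) (m := fun i => stdVec (f i))
  refine h.trans ?_
  rw [sum_smul_stdVec]
  refine Finset.sum_congr rfl fun m _ => ?_
  rw [MultilinearMap.map_update_smul, smul_eq_mul]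
  congr 1
  refine congrArg α (funext fun j => ?_)
  by_cases h : j = i
  · subst h; simp
  · simp [h]

/-- The endomorphism of `ℝ⁷` with matrix `c`. -/
def ofMatrix (c : Fin 7 → Fin 7 → ℝ) : R7 →L[ℝ] R7 :=
  ∑ a, (EuclideanSpace.proj a : R7 →L[ℝ] ℝ).smulRight (∑ m, c m a • stdVec m)

theorem ofMatrix_stdVec (c : Fin 7 → Fin 7 → ℝ) (a m : Fin 7) :
    ofMatrix c (stdVec a) m = c m a := by
  simp [ofMatrix, stdVec, Finset.sum_apply, Pi.single_apply]

/-- `B ↦ ∑ᵢ ψ₀(…, B ·, …)` has a linear right inverse: the `GL(7, ℝ)`-orbit of `ψ₀` is open. -/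
theorem exists_rightInverse_derivAct_psi0 :
    ∃ S : (R7 [⋀^Fin 4]→L[ℝ] ℝ) →L[ℝ] (R7 →L[ℝ] R7), ∀ β, derivAct psi0 (S β) = β := by
  let c (q : Fin 4 → Fin 7) (m a : Fin 7) : ℝ := monomialLift (q 0) (q 1) (q 2) (q 3) m a / 12
  let S : (R7 [⋀^Fin 4]→L[ℝ] ℝ) →L[ℝ] (R7 →L[ℝ] R7) := ∑ q : Fin 4 ↪o Fin 7,
    (ContinuousAlternatingMap.apply ℝ R7 ℝ (fun i => stdVec (q i))).smulRight (ofMatrix (c q))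
  have hc (q f : Fin 4 → Fin 7) (hq : StrictMono q) (hf : StrictMono f) :
      derivAct psi0 (ofMatrix (c q)) (fun i => stdVec (f i)) = if f = q then 1 else 0 := by
    have hq01 : q 0 < q 1 := hq (by decide)
    have hq12 : q 1 < q 2 := hq (by decide)
    have hq23 : q 2 < q 3 := hq (by decide)
    have hf01 : f 0 < f 1 := hf (by decide)
    have hf12 : f 1 < f 2 := hf (by decide)
    have hf23 : f 2 < f 3 := hf (by decide)
    have := forall_of_all7 (forall_of_all7 monomialLift_spec (q 0)) (q 1)
    rw [Bool.or_eq_true_iff, or_iff_right (by simpa using hq01)] at this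
    have := forall_of_all7 this (q 2)
    rw [Bool.or_eq_true_iff, or_iff_right (by simpa using hq12)] at this
    have := forall_of_all7 this (q 3)
    rw [Bool.or_eq_true_iff, or_iff_right (by simpa using hq23)] at this
    have := forall_of_all7 (forall_of_all7 this (f 0)) (f 1)
    rw [Bool.or_eq_true_iff, or_iff_right (by simpa using hf01)] at this
    have := forall_of_all7 this (f 2)
    rw [Bool.or_eq_true_iff, or_iff_right (by simpa using hf12)] at this
    have := forall_of_all7 this (f 3)
    rw [Bool.or_eq_true_iff, or_iff_right (by simpa using hf23), beq_iff_eq, sum7_eq] at this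
    have h1 := congrArg (Int.cast (R := ℝ)) this
    have h2 : derivAct psi0 (ofMatrix (c q)) (fun i => stdVec (f i)) = 1 / 12 *
        ((∑ m : Fin 7, (psiTab m (f 1) (f 2) (f 3) * monomialLift (q 0) (q 1) (q 2) (q 3) m (f 0)
        + psiTab (f 0) m (f 2) (f 3) * monomialLift (q 0) (q 1) (q 2) (q 3) m (f 1)
        + psiTab (f 0) (f 1) m (f 3) * monomialLift (q 0) (q 1) (q 2) (q 3) m (f 2)
        + psiTab (f 0) (f 1) (f 2) m * monomialLift (q 0) (q 1) (q 2) (q 3) m (f 3)) : ℤ) : ℝ) := by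
      rw [derivAct_stdVec]
      push_cast
      rw [Finset.mul_sum]
      refine Finset.sum_congr rfl fun m _ => ?_
      rw [Fin.sum_univ_four]
      simp only [ofMatrix_stdVec, psi0_stdVec, c]
      simp
      ring
    rw [h2, h1]
    have e : f = q ↔ (f 0 = q 0 ∧ f 1 = q 1 ∧ f 2 = q 2 ∧ f 3 = q 3) := by
      rw [funext_iff]; exact ⟨fun h => ⟨h 0, h 1, h 2, h 3⟩, fun h i => by fin_cases i <;> tauto⟩
    by_cases h : f = q
    · simp [h]
    · have h' := h
      rw [e] at h'
      rw [if_neg h]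
      have : (Nat.beq (f 0) (q 0) && Nat.beq (f 1) (q 1) && Nat.beq (f 2) (q 2)
          && Nat.beq (f 3) (q 3)) = false := by
        by_contra hcon
        simp only [Bool.not_eq_false, Bool.and_eq_true] at hcon
        exact h' ⟨Fin.ext (Nat.eq_of_beq_eq_true hcon.1.1.1),
          Fin.ext (Nat.eq_of_beq_eq_true hcon.1.1.2), Fin.ext (Nat.eq_of_beq_eq_true hcon.1.2),
          Fin.ext (Nat.eq_of_beq_eq_true hcon.2)⟩
      rw [this]
      simp
  refine ⟨S, fun β => ext_strictMono fun f hf => ?_⟩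
  have h1 : derivAct psi0 (S β) = ∑ q : Fin 4 ↪o Fin 7,
      β (fun i => stdVec (q i)) • derivAct psi0 (ofMatrix (c q)) := by
    simp [S, derivAct, map_sum]
  rw [h1, ContinuousAlternatingMap.sum_apply,
    Finset.sum_eq_single (OrderEmbedding.ofStrictMono f hf)]
  · rw [ContinuousAlternatingMap.smul_apply]
    simp [hc f f hf hf]
  · intro q _ hq
    have : f ≠ (q : Fin 4 → Fin 7) := by
      rintro rfl; exact hq (by ext; rfl)
    rw [ContinuousAlternatingMap.smul_apply, hc _ _ q.strictMono hf, if_neg this, smul_zero]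
  · simp

/-- The vector with components `½ ∑ C_{ij} φ_{ijm}`. On skew endomorphisms `C` it is, up to a
factor, the projection to the `7`-dimensional summand of `so(7) = g₂ ⊕ ℝ⁷`. -/
def skewVec (C : R7 →L[ℝ] R7) : R7 :=
  ∑ i, ∑ j, C (stdVec j) i • ∑ m : Fin 7, ((phiTab i j m : ℝ) / 2) • stdVec m

theorem skewVec_add (B C : R7 →L[ℝ] R7) : skewVec (B + C) = skewVec B + skewVec C := by
  simp [skewVec, add_smul, Finset.sum_add_distrib]

theorem skewVec_smul (r : ℝ) (C : R7 →L[ℝ] R7) : skewVec (r • C) = r • skewVec C := by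
  simp [skewVec, mul_smul, Finset.smul_sum]

/-- The infinitesimal rotations move `φ₀` inside `ℝ⁷ ⌟ ψ₀`, which is why `∇φ` has the form
`-(𝒯 · ⌟ ψ)`. -/
theorem derivAct_phi0_of_skew {C : R7 →L[ℝ] R7}
    (hC : ∀ x y, inner ℝ (C x) y + inner ℝ x (C y) = 0) (v : Fin 3 → R7) :
    derivAct phi0 C v = -psi0 (Matrix.vecCons (skewVec C) v) := by
  have hskew (i j : Fin 7) : C (stdVec i) j = -C (stdVec j) i := by
    have := hC (stdVec i) (stdVec j)
    rw [inner_stdVec_right, real_inner_comm, inner_stdVec_right] at this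
    linarith
  suffices h : derivAct phi0 C = -psi0.curryLeft (skewVec C) from congrArg (fun α => α v) h
  refine ext_strictMono fun f hf => ?_
  have h01 : f 0 < f 1 := hf (by decide)
  have h12 : f 1 < f 2 := hf (by decide)
  have hsym (i j : Fin 7) : skewCoeff i j (f 0) (f 1) (f 2) = skewCoeff j i (f 0) (f 1) (f 2) := by
    have := forall_of_all7 (forall_of_all7 (forall_of_all7 (forall_of_all7 skewCoeff_symm i) j)
      (f 0)) (f 1)
    rw [Bool.or_eq_true_iff, or_iff_right (by simpa using h01)] at this
    have := forall_of_all7 this (f 2)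
    rw [Bool.or_eq_true_iff, or_iff_right (by simpa using h12), beq_iff_eq] at this
    exact this
  -- the pairing of a skew with a symmetric matrix
  have hzero : ∑ i : Fin 7, ∑ j : Fin 7,
      C (stdVec j) i * (skewCoeff i j (f 0) (f 1) (f 2) : ℝ) = 0 := by
    have h1 : ∑ i : Fin 7, ∑ j : Fin 7, C (stdVec j) i * (skewCoeff i j (f 0) (f 1) (f 2) : ℝ)
        = -∑ i : Fin 7, ∑ j : Fin 7, C (stdVec j) i * (skewCoeff i j (f 0) (f 1) (f 2) : ℝ) := by
      conv_lhs => rw [Finset.sum_comm]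
      simp only [← Finset.sum_neg_distrib]
      refine Finset.sum_congr rfl fun i _ => Finset.sum_congr rfl fun j _ => ?_
      rw [hsym, hskew]; ring
    linarith
  have hl : 2 * derivAct phi0 C (fun i => stdVec (f i)) = ∑ i : Fin 7, ∑ j : Fin 7,
      C (stdVec j) i * (2 * ((if j = f 0 then (phiTab i (f 1) (f 2) : ℝ) else 0)
        + (if j = f 1 then (phiTab (f 0) i (f 2) : ℝ) else 0)
        + (if j = f 2 then (phiTab (f 0) (f 1) i : ℝ) else 0))) := by
    rw [derivAct_stdVec, Finset.mul_sum]
    refine Finset.sum_congr rfl fun i _ => ?_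
    simp only [Fin.sum_univ_three, phi0_stdVec, mul_add, mul_ite, mul_zero, Finset.sum_add_distrib,
      Finset.sum_ite_eq', Finset.mem_univ, if_true]
    simp
    ring
  have hr : 2 * psi0.curryLeft (skewVec C) (fun i => stdVec (f i)) = ∑ i : Fin 7, ∑ j : Fin 7,
      C (stdVec j) i * ∑ m : Fin 7, (phiTab i j m : ℝ) * psiTab m (f 0) (f 1) (f 2) := by
    have e (m : Fin 7) : psi0.curryLeft (stdVec m) (fun i => stdVec (f i))
        = psiTab m (f 0) (f 1) (f 2) := by
      rw [ContinuousAlternatingMap.curryLeft_apply_apply]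
      refine Eq.trans (congrArg psi0 ?_) (psi0_stdVec ![m, f 0, f 1, f 2])
      funext i; fin_cases i <;> rfl
    simp only [skewVec, map_sum, map_smul, ContinuousAlternatingMap.sum_apply,
      ContinuousAlternatingMap.smul_apply, e, smul_eq_mul, Finset.mul_sum]
    refine Finset.sum_congr rfl fun i _ => Finset.sum_congr rfl fun j _ =>
      Finset.sum_congr rfl fun m _ => ?_
    ring
  have hb (m n : Fin 7) (x : ℤ) : ((bif Nat.beq m n then x else 0 : ℤ) : ℝ)
      = if m = n then (x : ℝ) else 0 := by
    by_cases h : m = n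
    · subst h; simp
    · have : Nat.beq m n = false := by
        by_contra hcon
        rw [Bool.not_eq_false] at hcon
        exact h (Fin.ext (Nat.eq_of_beq_eq_true hcon))
      rw [this, if_neg h]; simp
  simp only [skewCoeff, sum7_eq] at hzero
  push_cast at hzero
  simp only [hb, mul_add, Finset.sum_add_distrib] at hzero
  simp only [mul_add, Finset.sum_add_distrib] at hl
  rw [← hr] at hzero
  rw [ContinuousAlternatingMap.neg_apply]
  linarith

open Filter Topology

/-! ### Derivatives of families of forms -/

theorem hasStrictFDerivAt_compContinuousLinearMap {k : ℕ} (α : R7 [⋀^Fin k]→L[ℝ] ℝ)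
    (A : R7 →L[ℝ] R7) :
    HasStrictFDerivAt (fun A => α.compContinuousLinearMap A) (α.fderivCompContinuousLinearMap A)
      A := by
  have := (hasStrictFDerivAt_const α A).continuousAlternatingMapCompContinuousLinearMap
    (hasStrictFDerivAt_id A)
  simpa using this

/-- `D_ψ(B) = -∑ᵢ ψ(…, B ·, …)`; the sign comes from the inverse in the action on forms. -/
theorem infAct_eq (ψ : R7 [⋀^Fin 4]→L[ℝ] ℝ) (B : R7 →L[ℝ] R7) : infAct ψ B = -derivAct ψ B := by
  have h2 : HasDerivAt (fun s : ℝ => -(s • B)) (-B) 0 := by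
    have := ((hasDerivAt_id (0 : ℝ)).smul_const B).neg
    rw [one_smul] at this
    exact this
  have e : -((0 : ℝ) • B) = 0 := neg_eq_zero.2 (zero_smul ℝ B)
  have h3 : HasFDerivAt (NormedSpace.exp : (R7 →L[ℝ] R7) → (R7 →L[ℝ] R7))
      (1 : (R7 →L[ℝ] R7) →L[ℝ] (R7 →L[ℝ] R7)) 0 := hasFDerivAt_exp_zero
  have h1 : HasDerivAt (fun s : ℝ => NormedSpace.exp (-(s • B))) (-B) 0 :=
    h3.comp_hasDerivAt_of_eq (0 : ℝ) h2 e.symm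
  have h4 := (hasStrictFDerivAt_compContinuousLinearMap ψ
    (ContinuousLinearMap.id ℝ R7)).hasFDerivAt
  have h5 := h4.comp_hasDerivAt_of_eq (0 : ℝ) h1
    ((congrArg NormedSpace.exp e).trans NormedSpace.exp_zero).symm
  rw [map_neg] at h5
  exact h5.deriv

/-- The velocity of the family `A_s ψ` is `D_{A_t ψ}(Ȧ_t A_t⁻¹)`. -/
theorem derivWithin_push {A : ℝ → R7 ≃L[ℝ] R7} {I : Set ℝ} {t : ℝ}
    (hI : UniqueDiffWithinAt ℝ I t)
    (hA : DifferentiableWithinAt ℝ (fun s => (A s : R7 →L[ℝ] R7)) I t)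
    (ψ : R7 [⋀^Fin 4]→L[ℝ] ℝ) :
    derivWithin (fun s => push (A s) ψ) I t = infAct (push (A t) ψ)
      (derivWithin (fun s => (A s : R7 →L[ℝ] R7)) I t ∘L ((A t).symm : R7 →L[ℝ] R7)) := by
  set B := derivWithin (fun s => (A s : R7 →L[ℝ] R7)) I t
  let x : (R7 →L[ℝ] R7)ˣ := (ContinuousLinearEquiv.unitsEquiv ℝ R7).symm (A t)
  have hx : (x : R7 →L[ℝ] R7) = A t := rfl
  -- `(A⁻¹)˙ = -A⁻¹ Ȧ A⁻¹`
  have hinv : HasDerivWithinAt (fun s => ((A s).symm : R7 →L[ℝ] R7))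
      (-(((A t).symm : R7 →L[ℝ] R7) ∘L B ∘L ((A t).symm : R7 →L[ℝ] R7))) I t := by
    have h1 := (hasFDerivAt_ringInverse (𝕜 := ℝ) x).comp_hasDerivWithinAt_of_eq t
      hA.hasDerivWithinAt hx
    have h2 : (Ring.inverse ∘ fun s => (A s : R7 →L[ℝ] R7))
        = fun s => ((A s).symm : R7 →L[ℝ] R7) := by
      funext s
      simp [ContinuousLinearMap.ringInverse_equiv]
    rw [h2] at h1
    exact h1
  have h3 := ((hasStrictFDerivAt_compContinuousLinearMap ψ
    ((A t).symm : R7 →L[ℝ] R7)).hasFDerivAt.comp_hasDerivWithinAt t hinv).derivWithin hI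
  refine h3.trans ?_
  rw [infAct_eq, map_neg]
  congr 1
  ext v
  rw [fderivComp_apply, derivAct_apply]
  refine Finset.sum_congr rfl fun i _ => ?_
  rw [push_apply]
  refine congrArg ψ (funext fun j => ?_)
  by_cases h : j = i
  · subst h; simp
  · simp [h]

/-! ### Differentiable frames -/

/-- Since the orbit of `ψ₀` is open, a family of `4`-forms differentiable at a point where its value
is `ψ₀` is, near that point, the pull-back of `ψ₀` by a differentiable family of endomorphisms. -/
theorem exists_differentiable_lift {β : R7 → R7 [⋀^Fin 4]→L[ℝ] ℝ} {x₀ : R7}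
    (hβ : DifferentiableAt ℝ β x₀) (h0 : β x₀ = psi0) :
    ∃ a : R7 → R7 →L[ℝ] R7, DifferentiableAt ℝ a x₀ ∧ a x₀ = ContinuousLinearMap.id ℝ R7 ∧
      ∀ᶠ x in 𝓝 x₀, psi0.compContinuousLinearMap (a x) = β x := by
  obtain ⟨S, hS⟩ := exists_rightInverse_derivAct_psi0
  let G : (R7 [⋀^Fin 4]→L[ℝ] ℝ) → R7 [⋀^Fin 4]→L[ℝ] ℝ := fun γ =>
    psi0.compContinuousLinearMap (ContinuousLinearMap.id ℝ R7 + S γ)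
  have hG : HasStrictFDerivAt G
      ((ContinuousLinearEquiv.refl ℝ (R7 [⋀^Fin 4]→L[ℝ] ℝ) :
        (R7 [⋀^Fin 4]→L[ℝ] ℝ) ≃L[ℝ] (R7 [⋀^Fin 4]→L[ℝ] ℝ)) :
        (R7 [⋀^Fin 4]→L[ℝ] ℝ) →L[ℝ] (R7 [⋀^Fin 4]→L[ℝ] ℝ)) 0 := by
    have h1 : HasStrictFDerivAt (fun γ => ContinuousLinearMap.id ℝ R7 + S γ) S 0 :=
      S.hasStrictFDerivAt.const_add _
    have h2 : HasStrictFDerivAt (fun A => psi0.compContinuousLinearMap A)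
        (psi0.fderivCompContinuousLinearMap (ContinuousLinearMap.id ℝ R7))
        (ContinuousLinearMap.id ℝ R7 + S 0) := by
      rw [map_zero, add_zero]
      exact hasStrictFDerivAt_compContinuousLinearMap _ _
    have e : psi0.fderivCompContinuousLinearMap (ContinuousLinearMap.id ℝ R7) ∘L S
        = ContinuousLinearMap.id ℝ (R7 [⋀^Fin 4]→L[ℝ] ℝ) := ContinuousLinearMap.ext fun γ => hS γ
    have h3 := h2.comp 0 h1
    rw [e] at h3
    exact h3
  have hG0 : G 0 = psi0 := by
    simp only [G, map_zero, add_zero]; rfl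
  set Ginv := HasStrictFDerivAt.localInverse G _ 0 hG
  have hinv0 : Ginv psi0 = 0 := by
    rw [← hG0]; exact hG.localInverse_apply_image
  have hd : DifferentiableAt ℝ Ginv (β x₀) := by
    have := hG.to_localInverse.differentiableAt
    rwa [hG0, ← h0] at this
  have hev : ∀ᶠ γ in 𝓝 (β x₀), G (Ginv γ) = γ := by
    have := hG.eventually_right_inverse
    rwa [hG0, ← h0] at this
  refine ⟨fun x => ContinuousLinearMap.id ℝ R7 + S (Ginv (β x)), ?_, ?_, ?_⟩
  · exact (S.differentiableAt.comp x₀ (hd.comp x₀ hβ)).const_add _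
  · simp [h0, hinv0]
  · exact hβ.continuousAt.eventually hev

/-- The same, starting from any frame in which the form has the model type. -/
theorem exists_differentiable_coframe {β : R7 → R7 [⋀^Fin 4]→L[ℝ] ℝ} {x₀ : R7}
    (hβ : DifferentiableAt ℝ β x₀) {u : R7 ≃L[ℝ] R7} (h0 : push u psi0 = β x₀) :
    ∃ b : R7 → R7 →L[ℝ] R7, DifferentiableAt ℝ b x₀ ∧ b x₀ = (u.symm : R7 →L[ℝ] R7) ∧
      ∀ᶠ x in 𝓝 x₀, psi0.compContinuousLinearMap (b x) = β x := by
  obtain ⟨a, ha, ha0, hev⟩ := exists_differentiable_lift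
    (β := fun x => (β x).compContinuousLinearMap (u : R7 →L[ℝ] R7)) (x₀ := x₀)
    (hβ.continuousAlternatingMapCompContinuousLinearMap (differentiableAt_const _))
    (by rw [← h0]; ext v; simp [push, Function.comp_def])
  refine ⟨fun x => a x ∘L (u.symm : R7 →L[ℝ] R7), ha.clm_comp (differentiableAt_const _), ?_, ?_⟩
  · change a x₀ ∘L (u.symm : R7 →L[ℝ] R7) = _
    rw [ha0]; rfl
  · filter_upwards [hev] with x hx
    have : β x = ((β x).compContinuousLinearMap (u : R7 →L[ℝ] R7)).compContinuousLinearMap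
        (u.symm : R7 →L[ℝ] R7) := by
      ext v; simp [Function.comp_def]
    rw [this, ← hx]; rfl

/-! ### The Levi-Civita connection and the torsion in a coframe -/

/-- Christoffel symbols of the first kind of the family `g` of bilinear forms on `ℝ⁷`. -/
def chrFirst (g : R7 → R7 → R7 → ℝ) (x X Y Z : R7) : ℝ :=
  (1 / 2 : ℝ) * (fderiv ℝ (fun y => g y Y Z) x X + fderiv ℝ (fun y => g y X Z) x Y
    - fderiv ℝ (fun y => g y X Y) x Z)

/-- Christoffel symbols of the second kind of the family `g` of bilinear forms on `ℝ⁷`. -/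
def chrSecond (g : R7 → R7 → R7 → ℝ) (x X Y : R7) : R7 :=
  let G : Matrix (Fin 7) (Fin 7) ℝ := Matrix.of fun i j => g x (stdVec i) (stdVec j)
  ∑ k, (∑ l, G⁻¹ k l * chrFirst g x X Y (stdVec l)) • stdVec k

section Coframe

variable {g : R7 → R7 → R7 → ℝ} {b : R7 → R7 →L[ℝ] R7} {x₀ : R7} {w : R7 ≃L[ℝ] R7}

/-- The derivative of the metric for which the coframe `b` is orthonormal. -/
theorem fderiv_metric (hb : DifferentiableAt ℝ b x₀)
    (hg : ∀ᶠ x in 𝓝 x₀, ∀ X Y, g x X Y = inner ℝ (b x X) (b x Y)) (X Y Z : R7) :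
    fderiv ℝ (fun y => g y Y Z) x₀ X
      = inner ℝ (fderiv ℝ b x₀ X Y) (b x₀ Z) + inner ℝ (b x₀ Y) (fderiv ℝ b x₀ X Z) := by
  have h1 : (fun y => g y Y Z) =ᶠ[𝓝 x₀] fun y => inner ℝ (b y Y) (b y Z) := by
    filter_upwards [hg] with x hx using hx Y Z
  have hd (V : R7) : DifferentiableAt ℝ (fun y => b y V) x₀ :=
    hb.clm_apply (differentiableAt_const V)
  have hf (V : R7) : fderiv ℝ (fun y => b y V) x₀ X = fderiv ℝ b x₀ X V := by
    rw [fderiv_clm_apply hb (differentiableAt_const V)]; simp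
  rw [h1.fderiv_eq, fderiv_inner_apply ℝ (hd Y) (hd Z), hf, hf, add_comm]

/-- The Christoffel symbols of the second kind are obtained by raising an index. -/
theorem inner_chrSecond (hb : DifferentiableAt ℝ b x₀)
    (hg : ∀ᶠ x in 𝓝 x₀, ∀ X Y, g x X Y = inner ℝ (b x X) (b x Y))
    (hw : b x₀ = (w : R7 →L[ℝ] R7)) (X Y Z : R7) :
    inner ℝ (w (chrSecond g x₀ X Y)) (w Z) = chrFirst g x₀ X Y Z := by
  set G : Matrix (Fin 7) (Fin 7) ℝ := Matrix.of fun i j => g x₀ (stdVec i) (stdVec j) with hG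
  have hg0 (X Y : R7) : g x₀ X Y = inner ℝ (w X) (w Y) := by
    rw [hg.self_of_nhds, hw]; rfl
  have hdet : G.det ≠ 0 := by
    intro h0
    obtain ⟨v, hv, hGv⟩ := Matrix.exists_mulVec_eq_zero_iff.2 h0
    refine hv ?_
    have h1 : inner ℝ (w (WithLp.toLp 2 v)) (w (WithLp.toLp 2 v)) = (0 : ℝ) := by
      have h2 (i : Fin 7) : inner ℝ (w (stdVec i)) (w (WithLp.toLp 2 v)) = (0 : ℝ) := by
        have := congrFun hGv i
        rw [← sum_smul_stdVec (WithLp.toLp 2 v), map_sum, inner_sum]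
        simpa [Matrix.mulVec, dotProduct, hG, hg0, inner_smul_right, mul_comm] using this
      have h3 : inner ℝ (w (∑ i, (WithLp.toLp 2 v : R7) i • stdVec i)) (w (WithLp.toLp 2 v))
          = (0 : ℝ) := by
        rw [map_sum, sum_inner]
        simp only [map_smul, inner_smul_left, h2, mul_zero, Finset.sum_const_zero]
      rwa [sum_smul_stdVec] at h3
    have h3 := inner_self_eq_zero.1 h1
    have h4 : WithLp.toLp 2 v = (0 : R7) := by simpa using h3
    simpa using congrArg (WithLp.ofLp) h4
  have hG1 : G⁻¹ * G = 1 := Matrix.nonsing_inv_mul _ (isUnit_iff_ne_zero.2 hdet)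
  have hGs (i j : Fin 7) : G i j = G j i := by
    simp only [hG, Matrix.of_apply, hg0]; exact real_inner_comm _ _
  have hGt : G * G⁻¹ = 1 := mul_eq_one_comm.1 hG1
  have hbasis (m : Fin 7) : inner ℝ (w (chrSecond g x₀ X Y)) (w (stdVec m))
      = chrFirst g x₀ X Y (stdVec m) := by
    change inner ℝ (w (∑ k, (∑ l, G⁻¹ k l * chrFirst g x₀ X Y (stdVec l)) • stdVec k))
      (w (stdVec m)) = _
    rw [map_sum, sum_inner]
    have h1 (k : Fin 7) : inner ℝ (w ((∑ l, G⁻¹ k l * chrFirst g x₀ X Y (stdVec l)) • stdVec k))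
        (w (stdVec m)) = ∑ l, (G m k * G⁻¹ k l) * chrFirst g x₀ X Y (stdVec l) := by
      rw [map_smul, inner_smul_left, ← hg0]
      change (∑ l, G⁻¹ k l * chrFirst g x₀ X Y (stdVec l)) * G k m = _
      rw [hGs k m, Finset.sum_mul]
      exact Finset.sum_congr rfl fun l _ => by ring
    simp only [h1]
    rw [Finset.sum_comm]
    simp only [← Finset.sum_mul, ← Matrix.mul_apply, hGt, Matrix.one_apply]
    simp
  conv_lhs => rw [← sum_smul_stdVec Z, map_sum, inner_sum]
  conv_rhs => rw [← sum_smul_stdVec Z]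
  simp only [map_smul, inner_smul_right, hbasis]
  simp only [chrFirst, fderiv_metric hb hg, hw, ContinuousLinearEquiv.coe_coe, map_sum, map_smul,
    inner_sum, sum_inner, inner_smul_left, inner_smul_right, _root_.sum_apply,
    _root_.smul_apply, ← Finset.sum_add_distrib, ← Finset.sum_sub_distrib,
    Finset.mul_sum]
  refine Finset.sum_congr rfl fun i _ => ?_
  simp only [RCLike.conj_to_real]
  ring

theorem chrSecond_comm (hgs : ∀ x X Y, g x X Y = g x Y X) (x X Y : R7) :
    chrSecond g x X Y = chrSecond g x Y X := by
  have h (Z : R7) : chrFirst g x X Y Z = chrFirst g x Y X Z := by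
    have e : (fun y => g y X Y) = fun y => g y Y X := funext fun y => hgs y X Y
    simp only [chrFirst, e]; ring
  simp only [chrSecond, h]

/-- The metric is parallel: the derivative of the coframe and the Christoffel symbols differ by
a skew endomorphism. -/
theorem metric_chrSecond (hb : DifferentiableAt ℝ b x₀)
    (hg : ∀ᶠ x in 𝓝 x₀, ∀ X Y, g x X Y = inner ℝ (b x X) (b x Y))
    (hw : b x₀ = (w : R7 →L[ℝ] R7)) (X Y Z : R7) :
    inner ℝ (w (chrSecond g x₀ X Y)) (w Z) + inner ℝ (w Y) (w (chrSecond g x₀ X Z))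
      = inner ℝ (fderiv ℝ b x₀ X Y) (w Z) + inner ℝ (w Y) (fderiv ℝ b x₀ X Z) := by
  rw [real_inner_comm (w (chrSecond g x₀ X Z)), inner_chrSecond hb hg hw,
    inner_chrSecond hb hg hw]
  have h1 := fderiv_metric hb hg
  rw [hw] at h1
  simp only [chrFirst, h1, ContinuousLinearEquiv.coe_coe]
  simp only [real_inner_comm]
  ring

theorem eq_of_inner_equiv {x y : R7} (h : ∀ Z, (inner ℝ (w x) (w Z) : ℝ) = inner ℝ (w y) (w Z)) :
    x = y := by
  refine w.injective (ext_inner_right ℝ fun v => ?_)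
  have := h (w.symm v)
  rwa [w.apply_symm_apply] at this

theorem exists_christoffel_bilinear (hb : DifferentiableAt ℝ b x₀)
    (hg : ∀ᶠ x in 𝓝 x₀, ∀ X Y, g x X Y = inner ℝ (b x X) (b x Y))
    (hw : b x₀ = (w : R7 →L[ℝ] R7)) :
    ∃ Γ : R7 →L[ℝ] R7 →L[ℝ] R7, ∀ X Y, Γ X Y = chrSecond g x₀ X Y := by
  have hfst (X Y Z : R7) := inner_chrSecond hb hg hw X Y Z
  have h1 := fderiv_metric hb hg
  let Γ : R7 →ₗ[ℝ] R7 →ₗ[ℝ] R7 := LinearMap.mk₂ ℝ (chrSecond g x₀)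
    (fun X X' Y => eq_of_inner_equiv (w := w) fun Z => by
      simp only [map_add, inner_add_left, hfst, chrFirst, h1, inner_add_right,
        _root_.add_apply]
      ring)
    (fun c X Y => eq_of_inner_equiv (w := w) fun Z => by
      simp only [map_smul, inner_smul_left, hfst, chrFirst, h1, inner_smul_right,
        _root_.smul_apply, RCLike.conj_to_real]
      ring)
    (fun X Y Y' => eq_of_inner_equiv (w := w) fun Z => by
      simp only [map_add, inner_add_left, hfst, chrFirst, h1, inner_add_right,
        _root_.add_apply]
      ring)
    (fun c X Y => eq_of_inner_equiv (w := w) fun Z => by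
      simp only [map_smul, inner_smul_left, hfst, chrFirst, h1, inner_smul_right,
        _root_.smul_apply, RCLike.conj_to_real]
      ring)
  exact ⟨LinearMap.toContinuousLinearMap
    ((LinearMap.toContinuousLinearMap : (R7 →ₗ[ℝ] R7) ≃ₗ[ℝ] _).toLinearMap ∘ₗ Γ),
    fun X Y => rfl⟩

/-- Existence of the intrinsic torsion in a coordinate chart. The difference of the derivative of
the coframe and of the connection is skew, and acts on `φ₀` by contraction of `ψ₀`. -/
theorem exists_torsion_of_coframe (hb : DifferentiableAt ℝ b x₀)
    (hg : ∀ᶠ x in 𝓝 x₀, ∀ X Y, g x X Y = inner ℝ (b x X) (b x Y))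
    (hw : b x₀ = (w : R7 →L[ℝ] R7)) {φ : R7 → R7 [⋀^Fin 3]→L[ℝ] ℝ}
    (hφ : ∀ᶠ x in 𝓝 x₀, φ x = phi0.compContinuousLinearMap (b x)) :
    ∃ T : R7 →L[ℝ] R7, ∀ X (v : Fin 3 → R7),
      fderiv ℝ φ x₀ X v - ∑ i, φ x₀ (Function.update v i (chrSecond g x₀ X (v i)))
        = -psi0.compContinuousLinearMap (w : R7 →L[ℝ] R7) (Matrix.vecCons (T X) v) := by
  obtain ⟨Γ, hΓ⟩ := exists_christoffel_bilinear hb hg hw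
  let C (X : R7) : R7 →L[ℝ] R7 :=
    (fderiv ℝ b x₀ X - (w : R7 →L[ℝ] R7) ∘L Γ X) ∘L (w.symm : R7 →L[ℝ] R7)
  have hCadd (X X' : R7) : C (X + X') = C X + C X' := by
    ext1 v; simp [C]; abel
  have hCsmul (c : ℝ) (X : R7) : C (c • X) = c • C X := by
    ext1 v; simp [C, smul_sub]
  have hskew (X y z : R7) : inner ℝ (C X y) z + inner ℝ y (C X z) = 0 := by
    have := metric_chrSecond hb hg hw X (w.symm y) (w.symm z)
    simp only [C, ContinuousLinearMap.comp_apply, _root_.sub_apply,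
      ContinuousLinearEquiv.coe_coe, inner_sub_left, inner_sub_right, hΓ]
    rw [w.apply_symm_apply, w.apply_symm_apply] at this
    linarith
  let T : R7 →ₗ[ℝ] R7 :=
    { toFun X := w.symm (skewVec (C X))
      map_add' X X' := by rw [hCadd, skewVec_add, map_add]
      map_smul' c X := by rw [hCsmul, skewVec_smul, map_smul]; rfl }
  refine ⟨LinearMap.toContinuousLinearMap T, fun X v => ?_⟩
  have hT : LinearMap.toContinuousLinearMap T X = w.symm (skewVec (C X)) := rfl
  have hφ' : HasFDerivAt φ ((phi0.fderivCompContinuousLinearMap (b x₀)) ∘L fderiv ℝ b x₀) x₀ :=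
    ((hasStrictFDerivAt_compContinuousLinearMap phi0 (b x₀)).hasFDerivAt.comp x₀
      hb.hasFDerivAt).congr_of_eventuallyEq hφ
  rw [hφ'.fderiv, hφ.self_of_nhds, ContinuousLinearMap.comp_apply, fderivComp_apply, hw,
    ← Finset.sum_sub_distrib]
  have key := derivAct_phi0_of_skew (hskew X) (fun j => w (v j))
  rw [derivAct_apply] at key
  have h1 : psi0.compContinuousLinearMap (w : R7 →L[ℝ] R7)
      (Matrix.vecCons (LinearMap.toContinuousLinearMap T X) v)
      = psi0 (Matrix.vecCons (skewVec (C X)) fun j => w (v j)) := by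
    rw [ContinuousAlternatingMap.compContinuousLinearMap_apply]
    refine congrArg psi0 (funext fun j => ?_)
    refine Fin.cases ?_ (fun j => ?_) j
    · simp [hT]
    · simp
  rw [h1, ← key]
  refine Finset.sum_congr rfl fun i _ => ?_
  have h2 : phi0.compContinuousLinearMap (w : R7 →L[ℝ] R7)
      (Function.update v i (chrSecond g x₀ X (v i)))
      = phi0 (Function.update (fun j => w (v j)) i (w (Γ X (v i)))) := by
    rw [ContinuousAlternatingMap.compContinuousLinearMap_apply, hΓ]
    refine congrArg phi0 (funext fun j => ?_)
    by_cases h : j = i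
    · subst h; simp
    · simp [h]
  have h3 : C X (w (v i)) = fderiv ℝ b x₀ X (v i) - w (Γ X (v i)) := by
    simp [C]
  rw [h2, h3]
  exact (phi0.map_update_sub _ _ _ _).symm

end Coframe

/-! ### The exterior derivative and symmetric connections -/

/-- A symmetric connection does not contribute to the alternation of the covariant derivative. -/
theorem alternating_sum_symmetric (φ : R7 [⋀^Fin 3]→L[ℝ] ℝ) {Γ : R7 → R7 → R7}
    (hΓ : ∀ X Y, Γ X Y = Γ Y X) (v : Fin 4 → R7) :
    ∑ i : Fin 4, (-1 : ℝ) ^ (i : ℕ) * ∑ j : Fin 3,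
      φ (Function.update (i.removeNth v) j (Γ (v i) (i.removeNth v j))) = 0 := by
  have hu (w : Fin 3 → R7) (x : R7) : Function.update w 0 x = ![x, w 1, w 2] ∧
      Function.update w 1 x = ![w 0, x, w 2] ∧ Function.update w 2 x = ![w 0, w 1, x] := by
    refine ⟨?_, ?_, ?_⟩ <;> (funext i; fin_cases i <;> rfl)
  have r0 : (0 : Fin 4).removeNth v = ![v 1, v 2, v 3] := by funext i; fin_cases i <;> rfl
  have r1 : (1 : Fin 4).removeNth v = ![v 0, v 2, v 3] := by funext i; fin_cases i <;> rfl
  have r2 : (2 : Fin 4).removeNth v = ![v 0, v 1, v 3] := by funext i; fin_cases i <;> rfl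
  have r3 : (3 : Fin 4).removeNth v = ![v 0, v 1, v 2] := by funext i; fin_cases i <;> rfl
  have s1 (a b c : R7) : φ ![b, a, c] = -φ ![a, b, c] := by
    have := φ.toAlternatingMap.map_swap ![a, b, c] (i := 0) (j := 1) (by decide)
    refine Eq.trans (congrArg φ ?_) this
    funext i; fin_cases i <;> rfl
  have s2 (a b c : R7) : φ ![b, c, a] = φ ![a, b, c] := by
    have := φ.toAlternatingMap.map_swap ![b, a, c] (i := 1) (j := 2) (by decide)
    have h : φ ![b, c, a] = -φ ![b, a, c] := by
      refine Eq.trans (congrArg φ ?_) this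
      funext i; fin_cases i <;> rfl
    rw [h, s1, neg_neg]
  simp only [Fin.sum_univ_four, Fin.sum_univ_three, r0, r1, r2, r3, (hu _ _).1, (hu _ _).2.1,
    (hu _ _).2.2]
  simp only [Matrix.cons_val_zero, Matrix.cons_val_one, Matrix.cons_val]
  simp only [s1 (Γ _ _) _ _, s2 (Γ _ _) _ _, hΓ (v 1) (v 0), hΓ (v 2) (v 0), hΓ (v 3) (v 0),
    hΓ (v 2) (v 1), hΓ (v 3) (v 1), hΓ (v 3) (v 2)]
  norm_num
  ring

/-- If `∇φ = -(T · ⌟ ψ)` for a symmetric connection `∇ = ∂ - Γ`, then `dφ = D_ψ(T)`. -/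
theorem extDeriv_eq_infAct {φ : R7 → R7 [⋀^Fin 3]→L[ℝ] ℝ} {x₀ : R7} {Γ : R7 → R7 → R7}
    (hΓ : ∀ X Y, Γ X Y = Γ Y X) {ψ : R7 [⋀^Fin 4]→L[ℝ] ℝ} {T : R7 →L[ℝ] R7}
    (hT : ∀ X (v : Fin 3 → R7),
      fderiv ℝ φ x₀ X v - ∑ i, φ x₀ (Function.update v i (Γ X (v i)))
        = -ψ (Matrix.vecCons (T X) v)) :
    extDeriv φ x₀ = infAct ψ T := by
  ext v
  rw [extDeriv, ContinuousAlternatingMap.alternatizeUncurryFin_apply, infAct_eq,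
    ContinuousAlternatingMap.neg_apply, derivAct_apply]
  have h1 (i : Fin 4) : fderiv ℝ φ x₀ (v i) (i.removeNth v)
      = ∑ j, φ x₀ (Function.update (i.removeNth v) j (Γ (v i) (i.removeNth v j)))
        - ψ (Matrix.vecCons (T (v i)) (i.removeNth v)) := by
    linarith [hT (v i) (i.removeNth v)]
  have h2 (i : Fin 4) : (-1 : ℝ) ^ (i : ℕ) * ψ (Matrix.vecCons (T (v i)) (i.removeNth v))
      = ψ (Function.update v i (T (v i))) := by
    have := ψ.map_insertNth i (T (v i)) (i.removeNth v)
    rw [Fin.insertNth_removeNth] at this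
    rw [this]
    simp [Matrix.vecCons]
  simp only [h1, zsmul_eq_mul]
  push_cast
  simp only [mul_sub, Finset.sum_sub_distrib, h2]
  rw [alternating_sum_symmetric (φ x₀) hΓ v, zero_sub]

section Manifold

variable {M : Type*} [TopologicalSpace M] [ChartedSpace R7 M]

/-! ### Independence of the Cayley frame -/

theorem isCayleyFrame_cayleyFrame {ε : Form M 7} {ψ : Form M 4} {p : M} {u : R7 ≃L[ℝ] Tan p}
    (hu : IsCayleyFrame ε ψ p u) : IsCayleyFrame ε ψ p (cayleyFrame ε ψ p) := by
  have h : ∃ u : R7 ≃L[ℝ] Tan p, IsCayleyFrame ε ψ p u := ⟨u, hu⟩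
  have e : cayleyFrame ε ψ p = h.choose := dif_pos h
  rw [e]
  exact h.choose_spec

/-- Two Cayley frames differ by an element of `GL⁺(7, ℝ)` fixing `ψ₀`. -/
theorem transition_cayleyFrame {ε : Form M 7} {ψ : Form M 4} {p : M} {u w : R7 ≃L[ℝ] Tan p}
    (hu : IsCayleyFrame ε ψ p u) (hw : IsCayleyFrame ε ψ p w) :
    (∀ v, psi0 (fun i => (w.trans u.symm) (v i)) = psi0 v) ∧
      0 < vol0 (fun i => (w.trans u.symm) (stdVec i)) := by
  constructor
  · intro v
    have h := congrArg (fun α => α (fun i => w (v i))) (hu.1.trans hw.1.symm)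
    simp only [push_apply, w.symm_apply_apply] at h
    exact h
  · have h := top_form_apply ((ε p).compContinuousLinearMap (u : R7 →L[ℝ] Tan p))
      (fun i => (w.trans u.symm) (stdVec i))
    have h1 : ((ε p).compContinuousLinearMap (u : R7 →L[ℝ] Tan p))
        (fun i => (w.trans u.symm) (stdVec i)) = ε p (fun i => w (stdVec i)) := by
      rw [ContinuousAlternatingMap.compContinuousLinearMap_apply]
      refine congrArg (ε p) (funext fun i => ?_)
      simp
    rw [h1] at h
    have h2 : 0 < ((ε p).compContinuousLinearMap (u : R7 →L[ℝ] Tan p)) (fun i => stdVec i) := hu.2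
    have h3 := hw.2
    rw [h] at h3
    exact (pos_iff_pos_of_mul_pos h3).1 h2

/-- The metric is computed by every Cayley frame, as the stabiliser of `ψ₀` is orthogonal. -/
theorem metric_eq_of_isCayleyFrame {ε : Form M 7} {ψ : Form M 4} {p : M} {u : R7 ≃L[ℝ] Tan p}
    (hu : IsCayleyFrame ε ψ p u) (X Y : Tan p) :
    metric ε ψ p X Y = inner ℝ (u.symm X) (u.symm Y) := by
  obtain ⟨h1, -⟩ := transition_cayleyFrame hu (isCayleyFrame_cayleyFrame hu)
  have h2 := inner_eq_of_psi0_invariant h1 ((cayleyFrame ε ψ p).symm X)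
    ((cayleyFrame ε ψ p).symm Y)
  simp only [ContinuousLinearEquiv.trans_apply, ContinuousLinearEquiv.apply_symm_apply] at h2
  exact h2.symm

/-- Every Cayley frame takes `φ` to the model. -/
theorem phi_eq_of_isCayleyFrame {ε : Form M 7} {ψ : Form M 4} {p : M} {u : R7 ≃L[ℝ] Tan p}
    (hu : IsCayleyFrame ε ψ p u) : phi ε ψ p = push u phi0 := by
  have hc := isCayleyFrame_cayleyFrame hu
  obtain ⟨h1, h2⟩ := transition_cayleyFrame hu hc
  have h3 : push (cayleyFrame ε ψ p).symm (ψ p) = psi0 := by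
    rw [← hc.1]
    ext v
    simp [push_apply]
  ext v
  rw [phi, h3, push_apply, push_apply]
  have h4 := phi0_invariant h1 h2 (fun i => (cayleyFrame ε ψ p).symm (v i))
  simp only [ContinuousLinearEquiv.trans_apply, ContinuousLinearEquiv.apply_symm_apply] at h4
  exact h4.symm

/-- The gauge transform of a `4`-form of type `ψ₀` has positive Cayley frames: if `A` reverses the
orientation, the negative of the transformed frame is positive, and `-1` fixes every `4`-form. -/
theorem exists_cayleyFrame_gaugeAct {ε : Form M 7} {ψ : Form M 4} {p : M} (hε0 : ε p ≠ 0)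
    (A : Gauge M) (h : ∃ u : R7 ≃L[ℝ] Tan p, IsCayleyFrame ε ψ p u) :
    ∃ u : R7 ≃L[ℝ] Tan p, IsCayleyFrame ε (gaugeAct A ψ) p u := by
  obtain ⟨u, hu⟩ := h
  have hψ : push (u.trans (A p)) psi0 = gaugeAct A ψ p := by
    rw [gaugeAct, ← hu.1]; rfl
  have hne : ε p (fun i => (u.trans (A p)) (stdVec i)) ≠ 0 := by
    intro h0
    refine hε0 ?_
    ext v
    have h1 := top_form_apply ((ε p).compContinuousLinearMap (u.trans (A p) : R7 →L[ℝ] Tan p))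
      (fun i => (u.trans (A p)).symm (v i))
    have h2 : ((ε p).compContinuousLinearMap (u.trans (A p) : R7 →L[ℝ] Tan p))
        (fun i => stdVec i) = 0 := h0
    rw [h2, zero_mul] at h1
    refine Eq.trans (congrArg (ε p) (funext fun i => ?_)) h1
    simp
  rcases lt_or_gt_of_ne hne with hneg | hpos
  · refine ⟨(ContinuousLinearEquiv.neg ℝ).trans (u.trans (A p)), ?_, ?_⟩
    · rw [← hψ]
      ext v
      rw [push_apply, push_apply]
      have h1 := psi0.toMultilinearMap.map_smul_univ (fun _ => (-1 : ℝ))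
        (fun i => (u.trans (A p)).symm (v i))
      have h2 : psi0 (fun i => (-1 : ℝ) • (u.trans (A p)).symm (v i))
          = psi0 (fun i => (u.trans (A p)).symm (v i)) := by
        refine h1.trans ?_
        simp
        ring
      rw [← h2]
      refine congrArg psi0 (funext fun i => ?_)
      rw [neg_one_smul]; rfl
    · have h1 := (ε p).toMultilinearMap.map_smul_univ (fun _ => (-1 : ℝ))
        (fun i => (u.trans (A p)) (stdVec i))
      have h2 : ε p (fun i => (-1 : ℝ) • (u.trans (A p)) (stdVec i))
          = -ε p (fun i => (u.trans (A p)) (stdVec i)) := by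
        refine h1.trans ?_
        simp
        ring
      have h3 : ε p (fun i => ((ContinuousLinearEquiv.neg ℝ).trans (u.trans (A p))) (stdVec i))
          = ε p (fun i => (-1 : ℝ) • (u.trans (A p)) (stdVec i)) := by
        refine congrArg (ε p) (funext fun i => ?_)
        rw [neg_one_smul]
        exact map_neg (u.trans (A p)) (stdVec i)
      rw [h3, h2]; linarith
  · exact ⟨_, hψ, hpos⟩

/-! ### Forms and gauge transformations in a chart -/

theorem metricInChart_comm (ε : Form M 7) (ψ : Form M 4) (p : M) (x X Y : R7) :
    metricInChart ε ψ p x X Y = metricInChart ε ψ p x Y X :=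
  real_inner_comm _ _

theorem christoffel_eq_chrSecond (ε : Form M 7) (ψ : Form M 4) (p : M) (X Y : R7) :
    christoffel ε ψ p X Y = chrSecond (metricInChart ε ψ p) (extChartAt (𝓡 7) p p) X Y := rfl

theorem IsSmoothForm.differentiableAt_inChart {k : ℕ} {α : Form M k} (hα : IsSmoothForm α) (p : M) :
    DifferentiableAt ℝ (inChart α p) (extChartAt (𝓡 7) p p) :=
  ((hα p).contDiffAt (extChartAt_target_mem_nhds (I := 𝓡 7) p)).differentiableAt (by simp)

variable [IsManifold (𝓡 7) ∞ M]

/-- Mathlib trivialises `T_pM` by the preferred chart at `p`, so the differential of that chart at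
`p` is the identity. -/
theorem chartDiff_self (p : M) : chartDiff p = ContinuousLinearMap.id ℝ R7 := by
  have : IsManifold (𝓡 7) 1 M := IsManifold.of_le (n := ∞) (by norm_cast)
  exact mfderiv_extChartAt_self

/-- The differentials of a chart and of its inverse are inverse to each other. -/
theorem exists_chartSymmDiff_equiv (p : M) {x : R7} (hx : x ∈ (extChartAt (𝓡 7) p).target) :
    ∃ c : R7 ≃L[ℝ] Tan ((extChartAt (𝓡 7) p).symm x),
      (c : R7 →L[ℝ] Tan ((extChartAt (𝓡 7) p).symm x)) = chartSymmDiff p x ∧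
      (c.symm : Tan ((extChartAt (𝓡 7) p).symm x) →L[ℝ] R7)
        = mfderiv (𝓡 7) (𝓡 7) (extChartAt (𝓡 7) p) ((extChartAt (𝓡 7) p).symm x) := by
  have : IsManifold (𝓡 7) 1 M := IsManifold.of_le (n := ∞) (by norm_cast)
  have h1 := mfderiv_extChartAt_comp_mfderivWithin_extChartAt_symm (I := 𝓡 7) hx
  have h2 := mfderivWithin_extChartAt_symm_comp_mfderiv_extChartAt (I := 𝓡 7) hx
  rw [ModelWithCorners.range_eq_univ, mfderivWithin_univ] at h1 h2
  exact ⟨ContinuousLinearEquiv.equivOfInverse (chartSymmDiff p x)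
    (mfderiv (𝓡 7) (𝓡 7) (extChartAt (𝓡 7) p) ((extChartAt (𝓡 7) p).symm x))
    (fun v => congrArg (fun L => L v) h1) (fun v => congrArg (fun L => L v) h2), rfl, rfl⟩

theorem inChart_self {k : ℕ} (α : Form M k) (p : M) : inChart α p (extChartAt (𝓡 7) p p) = α p := by
  have : IsManifold (𝓡 7) 1 M := IsManifold.of_le (n := ∞) (by norm_cast)
  -- the base point `κ⁻¹(κ(p))` is only propositionally equal to `p`
  have key (q : M) (hq : q = p) (L : R7 →L[ℝ] Tan q)
      (hL : mfderiv (𝓡 7) (𝓡 7) (extChartAt (𝓡 7) p) q ∘L L = ContinuousLinearMap.id ℝ R7) :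
      ((α q).compContinuousLinearMap L : R7 [⋀^Fin k]→L[ℝ] ℝ) = α p := by
    subst hq
    have h : L = ContinuousLinearMap.id ℝ R7 := by
      rw [mfderiv_extChartAt_self] at hL
      exact hL
    rw [h]; rfl
  refine key _ (extChartAt_to_inv p) _ ?_
  have h1 := mfderiv_extChartAt_comp_mfderivWithin_extChartAt_symm (I := 𝓡 7)
    (mem_extChartAt_target (I := 𝓡 7) p)
  rw [ModelWithCorners.range_eq_univ, mfderivWithin_univ] at h1
  exact h1

/-- In the trivialisation of the tangent bundle given by the chart at `p`, an automorphism of a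
nearby tangent space is conjugated by the differential `c` of the inverse chart. -/
theorem inCoordinates_tangent_eq {p q : M} (hq : q ∈ (chartAt R7 p).source) (c : R7 ≃L[ℝ] Tan q)
    (hc : (c.symm : Tan q →L[ℝ] R7) = mfderiv (𝓡 7) (𝓡 7) (extChartAt (𝓡 7) p) q)
    (B : Tan q ≃L[ℝ] Tan q) :
    ContinuousLinearMap.inCoordinates R7 (fun p : M => Tan p) R7
        (fun p : M => Tan p) p q p q (B : Tan q →L[ℝ] Tan q)
      = (((c.trans B).trans c.symm : R7 ≃L[ℝ] R7) : R7 →L[ℝ] R7) := by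
  have : IsManifold (𝓡 7) 1 M := IsManifold.of_le (n := ∞) (by norm_cast)
  have h1 : (trivializationAt R7 (fun p : M => Tan p) p).continuousLinearMapAt ℝ q
      = (c.symm : Tan q →L[ℝ] R7) :=
    (TangentBundle.continuousLinearMapAt_trivializationAt hq).trans hc.symm
  have h2 (y : R7) : (trivializationAt R7 (fun p : M => Tan p) p).symmL ℝ q y = c y := by
    have h3 := (trivializationAt R7 (fun p : M => Tan p) p).continuousLinearMapAt_symmL (R := ℝ)
      (b := q) hq y
    rw [h1] at h3
    exact (c.symm_apply_eq).1 h3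
  ext1 y
  change (trivializationAt R7 (fun p : M => Tan p) p).continuousLinearMapAt ℝ q
    (B ((trivializationAt R7 (fun p : M => Tan p) p).symmL ℝ q y)) = c.symm (B (c y))
  rw [h2, h1]
  rfl

/-- The local representation of a gauge transformation. -/
theorem IsSmoothGauge.exists_inChart {A : Gauge M} (hA : IsSmoothGauge A) (p : M) :
    ∃ a : R7 → R7 →L[ℝ] R7, DifferentiableAt ℝ a (extChartAt (𝓡 7) p p) ∧
      ∀ x ∈ (extChartAt (𝓡 7) p).target,
        ∀ c : R7 ≃L[ℝ] Tan ((extChartAt (𝓡 7) p).symm x),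
        (c.symm : Tan ((extChartAt (𝓡 7) p).symm x) →L[ℝ] R7)
          = mfderiv (𝓡 7) (𝓡 7) (extChartAt (𝓡 7) p) ((extChartAt (𝓡 7) p).symm x) →
        a x = (((c.trans (A ((extChartAt (𝓡 7) p).symm x))).trans c.symm : R7 ≃L[ℝ] R7) :
          R7 →L[ℝ] R7) := by
  have : IsManifold (𝓡 7) 1 M := IsManifold.of_le (n := ∞) (by norm_cast)
  let F (q : M) : R7 →L[ℝ] R7 := ContinuousLinearMap.inCoordinates R7 (fun p : M => Tan p) R7
    (fun p : M => Tan p) p q p q (A q : Tan q →L[ℝ] Tan q)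
  have hF : ContMDiffAt (𝓡 7) 𝓘(ℝ, R7 →L[ℝ] R7) ∞ F p := ((contMDiffAt_hom_bundle _).1 (hA p)).2
  have hs : ContMDiffAt (𝓡 7) (𝓡 7) ∞ (extChartAt (𝓡 7) p).symm (extChartAt (𝓡 7) p p) :=
    (contMDiffOn_extChartAt_symm p).contMDiffAt (extChartAt_target_mem_nhds p)
  have hcomp := (hF.comp_of_eq hs (extChartAt_to_inv p)).contDiffAt
  refine ⟨F ∘ (extChartAt (𝓡 7) p).symm, hcomp.differentiableAt (by simp), fun x hx c hc => ?_⟩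
  have hq : (extChartAt (𝓡 7) p).symm x ∈ (chartAt R7 p).source := by
    have := (extChartAt (𝓡 7) p).map_target hx
    rwa [extChartAt_source] at this
  exact inCoordinates_tangent_eq hq c hc _

theorem differentiableAt_inChart_gaugeAct {ψ : Form M 4} (hψ : IsSmoothForm ψ) {A : Gauge M}
    (hA : IsSmoothGauge A) (p : M) :
    DifferentiableAt ℝ (inChart (gaugeAct A ψ) p) (extChartAt (𝓡 7) p p) := by
  obtain ⟨a, ha, hax⟩ := hA.exists_inChart p
  have h1 : inChart (gaugeAct A ψ) p =ᶠ[𝓝 (extChartAt (𝓡 7) p p)] fun x =>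
      (inChart ψ p x).compContinuousLinearMap (ContinuousLinearMap.inverse (a x)) := by
    filter_upwards [extChartAt_target_mem_nhds (I := 𝓡 7) p] with x hx
    obtain ⟨c, hc, hc'⟩ := exists_chartSymmDiff_equiv p hx
    rw [hax x hx c hc', ContinuousLinearMap.inverse_equiv]
    simp only [inChart, ← hc]
    ext v
    simp only [ContinuousAlternatingMap.compContinuousLinearMap_apply, gaugeAct, push_apply]
    exact congrArg _ (funext fun i => (c.apply_symm_apply _).symm)
  refine DifferentiableAt.congr_of_eventuallyEq ?_ h1
  refine (hψ.differentiableAt_inChart p).continuousAlternatingMapCompContinuousLinearMap ?_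
  obtain ⟨c, -, hc⟩ := exists_chartSymmDiff_equiv p (mem_extChartAt_target (I := 𝓡 7) p)
  have h2 : DifferentiableAt ℝ (ContinuousLinearMap.inverse : (R7 →L[ℝ] R7) → (R7 →L[ℝ] R7))
      (a (extChartAt (𝓡 7) p p)) := by
    rw [hax _ (mem_extChartAt_target p) c hc]
    exact (contDiffAt_map_inverse (n := 1) _).differentiableAt (by simp)
  exact h2.comp _ ha

/-! ### The intrinsic torsion -/

/-- Near `p` there is a coframe, differentiable at `p`, bringing `ψ` to the model form. It is
invertible and positive near `p`, hence dual to Cayley frames, and therefore also computes the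
metric and `φ`. -/
theorem exists_local_coframe {ε : Form M 7} (hε : IsSmoothForm ε) {ψ : Form M 4} {p : M}
    (hψ : DifferentiableAt ℝ (inChart ψ p) (extChartAt (𝓡 7) p p))
    (hu : ∃ u : R7 ≃L[ℝ] Tan p, IsCayleyFrame ε ψ p u) :
    ∃ (b : R7 → R7 →L[ℝ] R7) (w : R7 ≃L[ℝ] R7),
      DifferentiableAt ℝ b (extChartAt (𝓡 7) p p) ∧
      b (extChartAt (𝓡 7) p p) = (w : R7 →L[ℝ] R7) ∧
      psi0.compContinuousLinearMap (w : R7 →L[ℝ] R7) = ψ p ∧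
      (∀ᶠ x in 𝓝 (extChartAt (𝓡 7) p p), ∀ X Y, metricInChart ε ψ p x X Y
        = inner ℝ (b x X) (b x Y)) ∧
      ∀ᶠ x in 𝓝 (extChartAt (𝓡 7) p p), inChart (phi ε ψ) p x
        = phi0.compContinuousLinearMap (b x) := by
  obtain ⟨u, hu⟩ := hu
  let u' : R7 ≃L[ℝ] R7 := u
  set x₀ := extChartAt (𝓡 7) p p with hx₀
  obtain ⟨b, hb, hb0, hev⟩ := exists_differentiable_coframe hψ (u := u')
    ((hu.1 : push u' psi0 = ψ p).trans (inChart_self ψ p).symm)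
  have hinv : ∀ᶠ x in 𝓝 x₀, ∃ w : R7 ≃L[ℝ] R7, (w : R7 →L[ℝ] R7) = b x := by
    have h1 : Set.range ((↑) : (R7 ≃L[ℝ] R7) → R7 →L[ℝ] R7) ∈ 𝓝 (b x₀) := by
      rw [hb0]; exact ContinuousLinearEquiv.nhds _
    exact hb.continuousAt.eventually h1
  have hpos : ∀ᶠ x in 𝓝 x₀, 0 < inChart ε p x
      (fun i => ContinuousLinearMap.inverse (b x) (stdVec i)) := by
    have h2 : DifferentiableAt ℝ (ContinuousLinearMap.inverse : (R7 →L[ℝ] R7) → (R7 →L[ℝ] R7))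
        (b x₀) := by
      rw [hb0]
      exact (contDiffAt_map_inverse (n := 1) _).differentiableAt (by simp)
    have h3 : ContinuousAt (fun x => inChart ε p x
        (fun i => ContinuousLinearMap.inverse (b x) (stdVec i))) x₀ :=
      ((hε.differentiableAt_inChart p).continuousAlternatingMap_apply fun i =>
        (h2.comp x₀ hb).clm_apply (differentiableAt_const (stdVec i))).continuousAt
    refine h3.eventually (lt_mem_nhds ?_)
    change 0 < inChart ε p x₀ (fun i => ContinuousLinearMap.inverse (b x₀) (stdVec i))
    rw [hb0, ContinuousLinearMap.inverse_equiv, hx₀, inChart_self]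
    exact hu.2
  -- the frame dual to the coframe is Cayley
  have hframe : ∀ᶠ x in 𝓝 x₀, ∃ c : R7 ≃L[ℝ] Tan ((extChartAt (𝓡 7) p).symm x),
      ∃ w : R7 ≃L[ℝ] R7, (c : R7 →L[ℝ] _) = chartSymmDiff p x ∧ (w : R7 →L[ℝ] R7) = b x ∧
      IsCayleyFrame ε ψ ((extChartAt (𝓡 7) p).symm x) (w.symm.trans c) := by
    filter_upwards [hev, hinv, hpos, extChartAt_target_mem_nhds (I := 𝓡 7) p] with x h1 h2 h3 hx
    obtain ⟨w, hw⟩ := h2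
    obtain ⟨c, hc, -⟩ := exists_chartSymmDiff_equiv p hx
    refine ⟨c, w, hc, hw, ?_, ?_⟩
    · ext v
      rw [push_apply]
      have h4 := congrArg (fun α => α (fun i => c.symm (v i))) h1
      simp only [inChart, ← hc, ← hw, ContinuousAlternatingMap.compContinuousLinearMap_apply] at h4
      exact h4.trans (congrArg _ (funext fun i => c.apply_symm_apply (v i)))
    · rw [← hw, ContinuousLinearMap.inverse_equiv] at h3
      simp only [inChart, ← hc, ContinuousAlternatingMap.compContinuousLinearMap_apply] at h3
      exact h3
  refine ⟨b, u'.symm, hb, hb0, hu.1, ?_, ?_⟩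
  · filter_upwards [hframe] with x ⟨c, w, hc, hw, hcay⟩ X Y
    rw [metricInChart, metric_eq_of_isCayleyFrame hcay, ← hc, ← hw]
    exact congrArg₂ _ (congrArg w (c.symm_apply_apply X)) (congrArg w (c.symm_apply_apply Y))
  · filter_upwards [hframe] with x ⟨c, w, hc, hw, hcay⟩
    rw [inChart, phi_eq_of_isCayleyFrame hcay, ← hc, ← hw]
    ext v
    exact congrArg phi0 (funext fun i => congrArg w (c.symm_apply_apply (v i)))

/-- The equation of the intrinsic torsion, written out in the preferred chart at the base point. -/
theorem isTorsionAt_iff {ε : Form M 7} {ψ : Form M 4} {p : M} {T : R7 →L[ℝ] R7} :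
    IsTorsionAt ε ψ p T ↔ ∀ (X : R7) (v : Fin 3 → R7),
      fderiv ℝ (inChart (phi ε ψ) p) (extChartAt (𝓡 7) p p) X v
        - ∑ i, inChart (phi ε ψ) p (extChartAt (𝓡 7) p p) (Function.update v i
          (chrSecond (metricInChart ε ψ p) (extChartAt (𝓡 7) p p) X (v i)))
        = -(ψ p : R7 [⋀^Fin 4]→L[ℝ] ℝ) (Matrix.vecCons (T X) v) := by
  refine forall_congr' fun X => forall_congr' fun v => ?_
  unfold covDeriv
  rw [chartDiff_self]
  simp only [christoffel_eq_chrSecond]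
  exact Iff.rfl

theorem isTorsionAt_intrinsicTorsion {ε : Form M 7} (hε : IsSmoothForm ε) {ψ : Form M 4} {p : M}
    (hψ : DifferentiableAt ℝ (inChart ψ p) (extChartAt (𝓡 7) p p))
    (hu : ∃ u : R7 ≃L[ℝ] Tan p, IsCayleyFrame ε ψ p u) :
    IsTorsionAt ε ψ p (intrinsicTorsion ε ψ p) := by
  obtain ⟨b, w, hb, hw, hψp, hg, hφ⟩ := exists_local_coframe hε hψ hu
  have hex : ∃ T : Tan p →L[ℝ] Tan p, IsTorsionAt ε ψ p T := by
    obtain ⟨T, hT⟩ := exists_torsion_of_coframe hb hg hw hφ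
    refine ⟨T, isTorsionAt_iff.2 ?_⟩
    rw [← hψp]
    exact hT
  have e : intrinsicTorsion ε ψ p = hex.choose := dif_pos hex
  rw [e]
  exact hex.choose_spec

/-- `dφ = D_ψ(𝒯)`, the alternation of `∇φ = -(𝒯 · ⌟ ψ)`. -/
theorem extD_phi_eq_infActAt {ε : Form M 7} (hε : IsSmoothForm ε) {ψ : Form M 4} {p : M}
    (hψ : DifferentiableAt ℝ (inChart ψ p) (extChartAt (𝓡 7) p p))
    (hu : ∃ u : R7 ≃L[ℝ] Tan p, IsCayleyFrame ε ψ p u) :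
    extD (phi ε ψ) p = infActAt ψ p (intrinsicTorsion ε ψ p) := by
  have hT := isTorsionAt_iff.1 (isTorsionAt_intrinsicTorsion hε hψ hu)
  have h1 := extDeriv_eq_infAct (Γ := chrSecond (metricInChart ε ψ p) (extChartAt (𝓡 7) p p))
    (chrSecond_comm (metricInChart_comm ε ψ p) _) hT
  rw [extD, h1, chartDiff_self]
  rfl

end Manifold

end G2Flow

end

theorem proposition3p1 {M : Type*} [TopologicalSpace M] [ChartedSpace G2Flow.R7 M]
    [IsManifold (𝓡 7) ∞ M]
    (ε : G2Flow.Form M 7) (hε : G2Flow.IsSmoothForm ε) (hε0 : ∀ p, ε p ≠ 0)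
    (ψ : G2Flow.Form M 4) (hψ : G2Flow.IsG2Structure ε ψ)
    (I : Set ℝ) (hI : I.OrdConnected) (hI' : I.Nontrivial)
    (A : ℝ → G2Flow.Gauge M) (hA : ∀ t ∈ I, G2Flow.IsSmoothGauge (A t))
    (hAt : ∀ p : M, DifferentiableOn ℝ
      (fun t => ((A t p : G2Flow.Tan p →L[ℝ] G2Flow.Tan p) : G2Flow.R7 →L[ℝ] G2Flow.R7)) I)
    (t : ℝ) (ht : t ∈ I) :
    G2Flow.formVelocity (fun s => G2Flow.gaugeAct (A s) ψ) I t
        = G2Flow.extD (G2Flow.phi ε (G2Flow.gaugeAct (A t) ψ)) ↔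
      ∀ p : M,
        G2Flow.infActAt (G2Flow.gaugeAct (A t) ψ) p
            (G2Flow.gaugeVelocity A I t p ∘L ((A t p).symm : G2Flow.Tan p →L[ℝ] G2Flow.Tan p))
          = G2Flow.infActAt (G2Flow.gaugeAct (A t) ψ) p
              (G2Flow.intrinsicTorsion ε (G2Flow.gaugeAct (A t) ψ) p) := by
  have hU : UniqueDiffWithinAt ℝ I t := by
    refine uniqueDiffWithinAt_convex hI.convex ?_ (subset_closure ht)
    obtain ⟨a, ha, b, hb, hab⟩ := hI'.exists_lt
    exact (Set.nonempty_Ioo.2 hab).mono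
      (interior_maximal (Set.Ioo_subset_Icc_self.trans (hI.out ha hb)) isOpen_Ioo)
  rw [funext_iff]
  refine forall_congr' fun p => ?_
  have h1 : G2Flow.formVelocity (fun s => G2Flow.gaugeAct (A s) ψ) I t p
      = G2Flow.infActAt (G2Flow.gaugeAct (A t) ψ) p
        (G2Flow.gaugeVelocity A I t p ∘L ((A t p).symm : G2Flow.Tan p →L[ℝ] G2Flow.Tan p)) :=
    G2Flow.derivWithin_push (A := fun s => A s p) hU (hAt p t ht) (ψ p)
  have h2 := G2Flow.extD_phi_eq_infActAt (p := p) hε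
    (G2Flow.differentiableAt_inChart_gaugeAct hψ.smooth (hA t ht) p)
    (G2Flow.exists_cayleyFrame_gaugeAct (hε0 p) (A t) (hψ.exists_cayleyFrame p))
  rw [h1, h2]
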